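/- Let $k$ be a field of characteristic $0$. An associative $2$-conformal algebra over $k$ is a $k$-space with bilinear products $x\langle m\rangle y$ ($m\in\mathbb Z_+^2$) and commuting linear maps $D_1,D_2$ such that: for all $x,y$ there is $N\in\mathbb Z_+^2$ with $x\langle m\rangle y=0$ whenever $m_i\ge N_i$ for some $i$; $D_i(x\langle m\rangle y)=D_ix\langle m\rangle y+x\langle m\rangle D_iy$; $D_ix\langle m\rangle y=-m_i\,x\langle m-e_i\rangle y$; and $(x\langle m\rangle y)\langle m'\rangle z=\sum_{s\le m}(-1)^{s_1+s_2}\binom{m_1}{s_1}\binom{m_2}{s_2}x\langle m-s\rangle(y\langle m'+s\rangle z)$. Let $C$ be the free such algebra on one generator $a$ with locality $(2,2)$, i.e. subject to $a\langle m\rangle a=0$ whenever $m_1\ge 2$ or $m_2\ge2$. Products without brackets are right normed: $u\langle m\rangle v\langle m'\rangle w=u\langle m\rangle(v\langle m'\rangle w)$. The normal words $a\langle m^{(1)}\rangle a\cdots a\langle m^{(r)}\rangle D^{i}a$ ($r\ge0$, $m^{(j)}\in\{0,1\}^2$, $i\in\mathbb Z_+^2$, $D^i=D_1^{i_1}D_2^{i_2}$)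 form a linear basis of $C$. Order them first by length $r+1$ and then lexicographically by $(m^{(1)},\dots,m^{(r)},i)$, multi-indices being compared lexicographically. Write $\bar x$ for the leading word of $x\ne0$, and $\bar xD^i$ for the word obtained from $\bar x$ by applying $D^i$ to its last letter. Call $x$ monic if its leading coefficient is $1$, and D-free if only words with $i=0$ occur in it. For a set $S$ of monic elements, a normal $S$-word is an element $[u\langle m\rangle t\langle m'\rangle v]$ with $t\in S$ D-free, whose leading word is $u\langle m\rangle\bar t\langle m'\rangle v$, or $[u\langle m\rangle D^it]$ with $t\in S$, whose leading word is $u\langle m\rangle\bar tD^i$. Here $u,v$ are (possibly empty) normal words, $u$ is D-free, $m,m'\in\{0,1\}^2$, and $[\;]$ is the right normed bracketing with $t$ (or $D^it$) as a single letter. The compositions of $x,y\in S$ are * $x-[u\langle m\rangle y\langle m'\rangle v]$ if $y$ is D-free and $w:=\bar x=u\langle m\rangle\bar y\langle m'\rangle v$; * $D^ix-[u\langle m\rangle D^jy]$ if $w:=\bar xD^i=u\langle m\rangle\bar yD^j$, where $i,j$ have disjoint supports; * $[x\langle m\rangle v]-[u\langle m'\rangle y]$ if $x$ is D-free and $w:=\bar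 x\langle m\rangle v=u\langle m'\rangle\bar y$ has length less than $|\bar x|+|\bar y|$; * $a\langle m\rangle x$ with $m_1\ge2$ or $m_2\ge2$, and, if $x$ is not D-free, $x\langle m\rangle a$ with any $m$. A composition of the first three kinds is trivial if it is a linear combination of normal $S$-words with leading words $<w$, all of them D-free if $x,y$ are D-free. A composition $c$ of the last kind is trivial if it is $0$ or a linear combination of normal $S$-words with leading words of length at most $|\bar c|$, all of them D-free in the case $x\langle m\rangle a$ and in the case $a\langle m\rangle x$ with $x$ D-free. $S$ is a Gröbner–Shirshov basis if all compositions of its elements are trivial. A normal word is $S$-irreducible if it is not the leading word of a normal $S$-word. **Theorem.** In $C$ put $$f=a\langle0,0\rangle a-a,\quad g=a\langle1,0\rangle a\langle1,0\rangle a,\quad h=a\langle0,1\rangle a\langle0,1\rangle a,$$ $$p=a\langle1,1\rangle a\langle1,0\rangle a,\quad q=a\langle1,1\rangle a\langle0,1\rangle a,\quad s=a\langle1,1\rangle a\langle1,1\rangle a,$$ and let $S=\{f,g,h,p,q,s\}$. Let $I$ be the ideal of $C$ (stable under $D_1,D_2$ and under all products from both sides) generated by $f$, and $G=C/I=C(\{a\},(2,2),D_1,D_2\mid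 a\langle0,0\rangle a=a)$. Then $S$ is a Gröbner–Shirshov basis and generates the ideal $I$. The $S$-irreducible normal words are exactly the words $$a\langle m^{(1)}\rangle a\langle m^{(2)}\rangle a\cdots a\langle m^{(r)}\rangle D_1^{i_1}D_2^{i_2}a,\qquad r,i_1,i_2\ge0,$$ in which $(m^{(1)},\dots,m^{(r)})$ is a (possibly empty) alternating sequence of $(1,0)$ and $(0,1)$, starting with either one, possibly followed by one final $(1,1)$. The images of these words form a linear basis of $G$. -/

import Mathlib

namespace NConformal

/-- Multi-indices in `ℤ₊ⁿ`. -/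
abbrev Idx (n : ℕ) := Fin n → ℕ

/-- `m ≺ l`: every coordinate of `m` is strictly below the one of `l`.  The condition `¬ Below m N`
(some `mᵢ ≥ Nᵢ`) is the one under which products vanish by locality. -/
def Below {n : ℕ} (m l : Idx n) : Prop := ∀ i, m i < l i

/-- The coefficient `(-1)^s (m choose s)` for multi-indices. -/
def coeff (k : Type*) [Field k] {n : ℕ} (m s : Idx n) : k :=
  (-1) ^ (∑ i, s i) * ∏ i, ((m i).choose (s i) : k)

/-- Operations of an `n`-conformal algebra: bilinear products `x ⟨m⟩ y` for `m ∈ ℤ₊ⁿ`, and linear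
maps `D₁, …, Dₙ`. -/
class ConformalOps (k : Type*) [Field k] (n : ℕ) (M : Type*) [AddCommGroup M] [Module k M] where
  op' : Idx n → M →ₗ[k] M →ₗ[k] M
  der' : Fin n → M →ₗ[k] M

section Ops

variable (k : Type*) [Field k] {n : ℕ} {M : Type*} [AddCommGroup M] [Module k M]
  [ConformalOps k n M]

/-- The product `x ⟨m⟩ y`, as a bilinear map. -/
def op (m : Idx n) : M →ₗ[k] M →ₗ[k] M := ConformalOps.op' m

/-- The derivation `Dᵢ`. -/
def der (i : Fin n) : M →ₗ[k] M := ConformalOps.der' i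

/-- `Dⁱ = D₁^{i₁} ⋯ Dₙ^{iₙ}`. -/
def derPow (i : Idx n) : Module.End k M :=
  (List.ofFn fun j => (der k j : Module.End k M) ^ (i j)).prod

end Ops

/-- The axioms of an associative `n`-conformal algebra. (For `m i = 0` the right-hand side of
`der_op` is `0`.) -/
class IsAssocConformal (k : Type*) [Field k] (n : ℕ) (M : Type*) [AddCommGroup M] [Module k M]
    [ConformalOps k n M] : Prop where
  der_comm : ∀ (i j : Fin n) (x : M), der k i (der k j x) = der k j (der k i x)
  locality : ∀ x y : M, ∃ N : Idx n, ∀ m : Idx n, ¬ Below m N → op k m x y = 0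
  leibniz : ∀ (i : Fin n) (m : Idx n) (x y : M),
    der k i (op k m x y) = op k m (der k i x) y + op k m x (der k i y)
  der_op : ∀ (i : Fin n) (m : Idx n) (x y : M),
    op k m (der k i x) y = -((m i : k) • op k (m - Pi.single i 1) x y)
  assoc : ∀ (m m' : Idx n) (x y z : M),
    op k m' (op k m x y) z =
      ∑ s ∈ Finset.Iic m, coeff k m s • op k (m - s) x (op k (m' + s) y z)

/-- Ideals: subspaces stable under all the derivations and under products from both sides. -/
structure IsConformalIdeal (k : Type*) [Field k] (n : ℕ) {M : Type*} [AddCommGroup M] [Module k M]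
    [ConformalOps k n M] (I : Submodule k M) : Prop where
  der_mem : ∀ (i : Fin n), ∀ x ∈ I, der k i x ∈ I
  op_left : ∀ (m : Idx n) (x : M), ∀ y ∈ I, op k m x y ∈ I
  op_right : ∀ (m : Idx n), ∀ x ∈ I, ∀ y : M, op k m x y ∈ I

/-- The ideal `Id(D^ω(X))` generated by a set `X`. -/
def idealSpan (k : Type*) [Field k] (n : ℕ) {M : Type*} [AddCommGroup M] [Module k M]
    [ConformalOps k n M] (X : Set M) : Submodule k M :=
  sInf {I | IsConformalIdeal k n I ∧ X ⊆ I}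

section Quotient

variable {k : Type*} [Field k] {n : ℕ} {M : Type*} [AddCommGroup M] [Module k M]
  [ConformalOps k n M]

theorem subset_idealSpan (X : Set M) : X ⊆ idealSpan k n X := by
  intro x hx
  simp only [idealSpan, SetLike.mem_coe, Submodule.mem_sInf]
  exact fun I hI => hI.2 hx

theorem idealSpan_le {X : Set M} {I : Submodule k M} (hI : IsConformalIdeal k n I)
    (hX : X ⊆ I) : idealSpan k n X ≤ I := sInf_le ⟨hI, hX⟩

theorem idealSpan_isIdeal (X : Set M) : IsConformalIdeal k n (idealSpan k n X) := by
  constructor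
  · intro i x hx
    simp only [idealSpan, Submodule.mem_sInf] at hx ⊢
    exact fun I hI => hI.1.der_mem i x (hx I hI)
  · intro m x y hy
    simp only [idealSpan, Submodule.mem_sInf] at hy ⊢
    exact fun I hI => hI.1.op_left m x y (hy I hI)
  · intro m x hx y
    simp only [idealSpan, Submodule.mem_sInf] at hx ⊢
    exact fun I hI => hI.1.op_right m x (hx I hI) y

/-- The product induced on the quotient by an ideal. -/
def quotOp {I : Submodule k M} (hI : IsConformalIdeal k n I) (m : Idx n) :
    (M ⧸ I) →ₗ[k] (M ⧸ I) →ₗ[k] (M ⧸ I) :=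
  (I.liftQ (I.liftQ ((op k m : M →ₗ[k] M →ₗ[k] M).compr₂ I.mkQ) (by
    intro x hx
    ext y
    simpa using hI.op_right m x hx y)).flip (by
    intro y hy
    ext x
    simp only [LinearMap.coe_comp, Function.comp_apply, LinearMap.flip_apply,
      Submodule.mkQ_apply, LinearMap.zero_apply]
    exact (Submodule.Quotient.mk_eq_zero I).2 (hI.op_left m x y hy))).flip

instance (X : Set M) : ConformalOps k n (M ⧸ idealSpan k n X) where
  op' m := quotOp (idealSpan_isIdeal X) m
  der' i := (idealSpan k n X).mapQ (idealSpan k n X) (der k i)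
    (fun x hx => (idealSpan_isIdeal X).der_mem i x hx)

theorem op_mk (X : Set M) (m : Idx n) (x y : M) :
    op k m ((idealSpan k n X).mkQ x) ((idealSpan k n X).mkQ y)
      = (idealSpan k n X).mkQ (op k m x y) := rfl

theorem der_mk (X : Set M) (i : Fin n) (x : M) :
    der k i ((idealSpan k n X).mkQ x) = (idealSpan k n X).mkQ (der k i x) := rfl

/-- A quotient of an associative `n`-conformal algebra by an ideal is one. -/
instance (X : Set M) [IsAssocConformal k n M] :
    IsAssocConformal k n (M ⧸ idealSpan k n X) := by
  have hs := (idealSpan k n X).mkQ_surjective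
  constructor
  · intro i j x
    obtain ⟨x, rfl⟩ := hs x
    simp only [der_mk, IsAssocConformal.der_comm i j x]
  · intro x y
    obtain ⟨x, rfl⟩ := hs x
    obtain ⟨y, rfl⟩ := hs y
    obtain ⟨N, hN⟩ := IsAssocConformal.locality (k := k) (n := n) x y
    exact ⟨N, fun m hm => by rw [op_mk, hN m hm, map_zero]⟩
  · intro i m x y
    obtain ⟨x, rfl⟩ := hs x
    obtain ⟨y, rfl⟩ := hs y
    simp only [op_mk, der_mk, IsAssocConformal.leibniz, map_add]
  · intro i m x y
    obtain ⟨x, rfl⟩ := hs x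
    obtain ⟨y, rfl⟩ := hs y
    simp only [op_mk, der_mk, IsAssocConformal.der_op, map_neg, map_smul]
  · intro m m' x y z
    obtain ⟨x, rfl⟩ := hs x
    obtain ⟨y, rfl⟩ := hs y
    obtain ⟨z, rfl⟩ := hs z
    simp only [op_mk, IsAssocConformal.assoc, map_sum, map_smul]

end Quotient

/-! The free associative `n`-conformal algebra. -/

/-- Nonassociative words in the letters `B` and the operations `⟨m⟩`, `Dᵢ`. -/
inductive Term (n : ℕ) (B : Type*)
  | gen (b : B) : Term n B
  | der (i : Fin n) (t : Term n B) : Term n B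
  | op (m : Idx n) (s t : Term n B) : Term n B

section Free

variable (k : Type*) [Field k] {n : ℕ} {B : Type*}

/-- On the space with basis the nonassociative words, the operations are formal. -/
noncomputable instance : ConformalOps k n (Term n B →₀ k) where
  op' m := Finsupp.lsum k fun s =>
    LinearMap.toSpanSingleton k _ (Finsupp.lmapDomain k k (Term.op m s))
  der' i := Finsupp.lmapDomain k k (Term.der i)

/-- The identities of an associative `n`-conformal algebra with locality function `N` on the
generators. -/
inductive FreeRel (N : B → B → Idx n) : (Term n B →₀ k) → Prop
  | der_comm (i j : Fin n) (x : Term n B →₀ k) :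
      FreeRel N (der k i (der k j x) - der k j (der k i x))
  | locality (a b : B) (m : Idx n) (hm : ¬ Below m (N a b)) :
      FreeRel N (op k m (Finsupp.single (Term.gen a) 1) (Finsupp.single (Term.gen b) 1))
  | leibniz (i : Fin n) (m : Idx n) (x y : Term n B →₀ k) :
      FreeRel N (der k i (op k m x y) - (op k m (der k i x) y + op k m x (der k i y)))
  | der_op (i : Fin n) (m : Idx n) (x y : Term n B →₀ k) :
      FreeRel N (op k m (der k i x) y - -((m i : k) • op k (m - Pi.single i 1) x y))
  | assoc (m m' : Idx n) (x y z : Term n B →₀ k) :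
      FreeRel N (op k m' (op k m x y) z -
        ∑ s ∈ Finset.Iic m, coeff k m s • op k (m - s) x (op k (m' + s) y z))

/-- The free associative `n`-conformal algebra `C(B, N, D₁, …, Dₙ)`. -/
abbrev FreeConf (N : B → B → Idx n) : Type _ :=
  (Term n B →₀ k) ⧸ idealSpan k n {x | FreeRel k N x}

variable {k}

/-- The generators of the free associative `n`-conformal algebra. -/
noncomputable def gen (N : B → B → Idx n) (b : B) : FreeConf k N :=
  (idealSpan k n {x | FreeRel k N x}).mkQ (Finsupp.single (Term.gen b) 1)

theorem mkQ_eq_zero {N : B → B → Idx n} {x : Term n B →₀ k} (h : FreeRel k N x) :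
    (idealSpan k n {x | FreeRel k N x}).mkQ x = 0 := by
  rw [Submodule.mkQ_apply, Submodule.Quotient.mk_eq_zero]
  exact subset_idealSpan _ h

theorem mkQ_eq {N : B → B → Idx n} {x y : Term n B →₀ k} (h : FreeRel k N (x - y)) :
    (idealSpan k n {x | FreeRel k N x}).mkQ x = (idealSpan k n {x | FreeRel k N x}).mkQ y := by
  rw [← sub_eq_zero, ← map_sub, mkQ_eq_zero h]

theorem free_induction {N : B → B → Idx n} {P : FreeConf k N → Prop} (h0 : P 0)
    (hadd : ∀ x y, P x → P y → P (x + y)) (hsmul : ∀ (r : k) x, P x → P (r • x))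
    (hgen : ∀ b, P (gen N b)) (hder : ∀ (i : Fin n) x, P x → P (der k i x))
    (hop : ∀ (m : Idx n) x y, P x → P y → P (op k m x y)) (x : FreeConf k N) : P x := by
  obtain ⟨x, rfl⟩ := Submodule.mkQ_surjective _ x
  induction x using Finsupp.induction_linear with
  | zero => simpa using h0
  | add f g hf hg => rw [map_add]; exact hadd _ _ hf hg
  | single t r =>
    have h1 : P ((idealSpan k n {x | FreeRel k N x}).mkQ (Finsupp.single t 1)) := by
      induction t with
      | gen b => exact hgen b
      | der i t ih =>
        have := hder i _ ih
        rw [der_mk] at this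
        simpa [der, ConformalOps.der'] using this
      | op m s t ihs iht =>
        have := hop m _ _ ihs iht
        rw [op_mk] at this
        simpa [op, ConformalOps.op'] using this
    have := hsmul r _ h1
    rw [← map_smul] at this
    simpa using this

theorem free_der_comm (N : B → B → Idx n) (i j : Fin n) (x : FreeConf k N) :
    der k i (der k j x) = der k j (der k i x) := by
  obtain ⟨x, rfl⟩ := Submodule.mkQ_surjective _ x
  exact mkQ_eq (FreeRel.der_comm i j x)

theorem free_leibniz (N : B → B → Idx n) (i : Fin n) (m : Idx n) (x y : FreeConf k N) :
    der k i (op k m x y) = op k m (der k i x) y + op k m x (der k i y) := by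
  obtain ⟨x, rfl⟩ := Submodule.mkQ_surjective _ x
  obtain ⟨y, rfl⟩ := Submodule.mkQ_surjective _ y
  exact mkQ_eq (FreeRel.leibniz i m x y)

theorem free_der_op (N : B → B → Idx n) (i : Fin n) (m : Idx n) (x y : FreeConf k N) :
    op k m (der k i x) y = -((m i : k) • op k (m - Pi.single i 1) x y) := by
  obtain ⟨x, rfl⟩ := Submodule.mkQ_surjective _ x
  obtain ⟨y, rfl⟩ := Submodule.mkQ_surjective _ y
  exact mkQ_eq (FreeRel.der_op i m x y)

theorem free_assoc (N : B → B → Idx n) (m m' : Idx n) (x y z : FreeConf k N) :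
    op k m' (op k m x y) z =
      ∑ s ∈ Finset.Iic m, coeff k m s • op k (m - s) x (op k (m' + s) y z) := by
  obtain ⟨x, rfl⟩ := Submodule.mkQ_surjective _ x
  obtain ⟨y, rfl⟩ := Submodule.mkQ_surjective _ y
  obtain ⟨z, rfl⟩ := Submodule.mkQ_surjective _ z
  have := mkQ_eq (FreeRel.assoc (N := N) m m' x y z)
  simp only [map_sum, map_smul] at this
  exact this

theorem free_gen_local (N : B → B → Idx n) (a b : B) (m : Idx n) (hm : ¬ Below m (N a b)) :
    op k m (gen N a : FreeConf k N) (gen N b) = 0 :=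
  mkQ_eq_zero (FreeRel.locality a b m hm)

theorem Below.mono {m l l' : Idx n} (h : Below m l) (hl : l ≤ l') : Below m l' :=
  fun i => (h i).trans_le (hl i)

/-- Products of local elements are local. -/
theorem free_dong (N : B → B → Idx n) (x u v : FreeConf k N) (N₁ N₂ : Idx n)
    (h₁ : ∀ m, ¬ Below m N₁ → op k m x u = 0) (h₂ : ∀ m, ¬ Below m N₂ → op k m u v = 0)
    (j : Fin n) (d : ℕ) : ∀ (m p : Idx n), ∑ i, m i = d → N₁ j + N₂ j ≤ m j + p j →
      op k m x (op k p u v) = 0 := by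
  induction d using Nat.strong_induction_on with
  | _ d ih =>
    intro m p hd hj
    by_cases hp : N₂ j ≤ p j
    · rw [h₂ p (fun h => absurd (h j) (by omega)), map_zero]
    · have h0 : op k m x u = 0 := h₁ m (fun h => absurd (h j) (by omega))
      have hA := free_assoc N m p x u v
      rw [h0, map_zero, LinearMap.zero_apply,
        Finset.sum_eq_single_of_mem (0 : Idx n) (Finset.mem_Iic.2 (fun i => Nat.zero_le _))] at hA
      · simpa [coeff] using hA.symm
      · intro s hs hs0
        have hsm : s ≤ m := Finset.mem_Iic.1 hs
        rw [ih (∑ i, (m - s) i) _ (m - s) (p + s) rfl, smul_zero]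
        · have := hsm j
          simp only [Pi.sub_apply, Pi.add_apply]
          omega
        · rw [← hd]
          obtain ⟨i, hi⟩ := Function.ne_iff.1 hs0
          refine Finset.sum_lt_sum (fun i _ => Nat.sub_le _ _) ⟨i, Finset.mem_univ _, ?_⟩
          have := hsm i
          simp only [Pi.sub_apply, Pi.zero_apply] at *
          omega

theorem not_below_sub {m l : Idx n} {i : Fin n} (h : ¬ Below m (l + Pi.single i 1)) :
    ¬ Below (m - Pi.single i 1) l := by
  intro h'
  apply h
  intro j
  have := h' j
  simp only [Pi.sub_apply, Pi.add_apply] at *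
  omega

theorem free_locality (N : B → B → Idx n) (y : FreeConf k N) : ∀ x : FreeConf k N,
    ∃ L : Idx n, ∀ m : Idx n, ¬ Below m L → op k m x y = 0 := by
  induction y using free_induction with
  | h0 => exact fun x => ⟨0, fun m _ => map_zero _⟩
  | hadd y z hy hz =>
    intro x
    obtain ⟨L, hL⟩ := hy x
    obtain ⟨L', hL'⟩ := hz x
    refine ⟨L ⊔ L', fun m hm => ?_⟩
    rw [map_add, hL m (fun h => hm (h.mono le_sup_left)),
      hL' m (fun h => hm (h.mono le_sup_right)), add_zero]
  | hsmul r y hy =>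
    intro x
    obtain ⟨L, hL⟩ := hy x
    exact ⟨L, fun m hm => by rw [map_smul, hL m hm, smul_zero]⟩
  | hder i y hy =>
    intro x
    obtain ⟨L, hL⟩ := hy x
    refine ⟨L + Pi.single i 1, fun m hm => ?_⟩
    have h1 := free_leibniz N i m x y
    rw [hL m (fun h => hm (h.mono le_self_add)), map_zero, free_der_op,
      hL _ (not_below_sub hm)] at h1
    simpa using h1.symm
  | hop p u v hu hv =>
    intro x
    obtain ⟨L, hL⟩ := hu x
    obtain ⟨L', hL'⟩ := hv u
    refine ⟨L + L', fun m hm => ?_⟩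
    simp only [Below, not_forall, not_lt] at hm
    obtain ⟨j, hj⟩ := hm
    refine free_dong N x u v L L' hL hL' j _ m p rfl ?_
    simp only [Pi.add_apply] at hj
    omega
  | hgen b =>
    intro x
    induction x using free_induction with
    | h0 => exact ⟨0, fun m _ => by rw [map_zero, LinearMap.zero_apply]⟩
    | hadd y z hy hz =>
      obtain ⟨L, hL⟩ := hy
      obtain ⟨L', hL'⟩ := hz
      refine ⟨L ⊔ L', fun m hm => ?_⟩
      rw [map_add, LinearMap.add_apply, hL m (fun h => hm (h.mono le_sup_left)),
        hL' m (fun h => hm (h.mono le_sup_right)), add_zero]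
    | hsmul r y hy =>
      obtain ⟨L, hL⟩ := hy
      exact ⟨L, fun m hm => by rw [map_smul, LinearMap.smul_apply, hL m hm, smul_zero]⟩
    | hgen a => exact ⟨N a b, fun m hm => free_gen_local N a b m hm⟩
    | hder i y hy =>
      obtain ⟨L, hL⟩ := hy
      refine ⟨L + Pi.single i 1, fun m hm => ?_⟩
      rw [free_der_op, hL _ (not_below_sub hm), smul_zero, neg_zero]
    | hop p u v _ hv =>
      obtain ⟨L, hL⟩ := hv
      refine ⟨L, fun m hm => ?_⟩
      rw [free_assoc]
      refine Finset.sum_eq_zero fun s _ => ?_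
      rw [hL (m + s) (fun h => hm (fun i => lt_of_le_of_lt (Nat.le_add_right _ _) (h i))),
        map_zero, smul_zero]

instance (N : B → B → Idx n) : IsAssocConformal k n (FreeConf k N) where
  der_comm := free_der_comm N
  locality x y := free_locality N y x
  leibniz := free_leibniz N
  der_op := free_der_op N
  assoc := free_assoc N

/-- The value of a nonassociative word under a substitution of the generators. -/
def Term.eval {A : Type*} [AddCommGroup A] [Module k A] [ConformalOps k n A] (e : B → A) :
    Term n B → A
  | .gen b => e b
  | .der i t => NConformal.der k i (t.eval e)
  | .op m s t => NConformal.op k m (s.eval e) (t.eval e)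

/-- The universal property of the free associative `n`-conformal algebra. -/
theorem free_universal {A : Type*} [AddCommGroup A] [Module k A] [ConformalOps k n A]
    [IsAssocConformal k n A] (N : B → B → Idx n) (e : B → A)
    (he : ∀ (a b : B) (m : Idx n), ¬ Below m (N a b) → op k m (e a) (e b) = 0) :
    ∃! φ : FreeConf k N →ₗ[k] A, (∀ b, φ (gen N b) = e b) ∧
      (∀ (i : Fin n) x, φ (der k i x) = der k i (φ x)) ∧
      (∀ (m : Idx n) x y, φ (op k m x y) = op k m (φ x) (φ y)) := by
  let ψ : (Term n B →₀ k) →ₗ[k] A := Finsupp.linearCombination k (Term.eval (k := k) e)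
  have hder : ∀ (i : Fin n) x, ψ (der k i x) = der k i (ψ x) := by
    intro i x
    induction x using Finsupp.induction_linear with
    | zero => simp
    | add f g hf hg => simp only [map_add, hf, hg]
    | single t r => simp [ψ, der, ConformalOps.der', Term.eval]
  have hop : ∀ (m : Idx n) x y, ψ (op k m x y) = op k m (ψ x) (ψ y) := by
    intro m x y
    induction x using Finsupp.induction_linear with
    | zero => simp
    | add f g hf hg => simp only [map_add, LinearMap.add_apply, hf, hg]
    | single t r =>
      induction y using Finsupp.induction_linear with
      | zero => simp
      | add f g hf hg => simp only [map_add, hf, hg]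
      | single t' r' =>
        simp [ψ, op, ConformalOps.op', Term.eval, mul_smul, smul_comm r r', -Finsupp.single_mul]
  have hker : idealSpan k n {x | FreeRel k N x} ≤ LinearMap.ker ψ := by
    apply idealSpan_le
    · constructor
      · intro i x hx
        rw [LinearMap.mem_ker] at *
        rw [hder, hx, map_zero]
      · intro m x y hy
        rw [LinearMap.mem_ker] at *
        rw [hop, hy, map_zero]
      · intro m x hx y
        rw [LinearMap.mem_ker] at *
        rw [hop, hx, map_zero, LinearMap.zero_apply]
    · intro x hx
      rw [SetLike.mem_coe, LinearMap.mem_ker]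
      cases hx with
      | der_comm i j x =>
        rw [map_sub, sub_eq_zero, hder, hder, hder, hder, IsAssocConformal.der_comm]
      | locality a b m hm => rw [hop]; simpa [ψ, Term.eval] using he a b m hm
      | leibniz i m x y =>
        simp only [map_sub, map_add, hder, hop, IsAssocConformal.leibniz, sub_self]
      | der_op i m x y =>
        simp only [map_sub, map_neg, map_smul, hder, hop, IsAssocConformal.der_op, sub_self]
      | assoc m m' x y z =>
        simp only [map_sub, map_sum, map_smul, hop, IsAssocConformal.assoc, sub_self]
  refine ⟨Submodule.liftQ _ ψ hker, ⟨?_, ?_, ?_⟩, ?_⟩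
  · intro b
    simp [gen, ψ, Term.eval]
  · intro i x
    obtain ⟨x, rfl⟩ := Submodule.mkQ_surjective _ x
    exact hder i x
  · intro m x y
    obtain ⟨x, rfl⟩ := Submodule.mkQ_surjective _ x
    obtain ⟨y, rfl⟩ := Submodule.mkQ_surjective _ y
    exact hop m x y
  · rintro φ ⟨h1, h2, h3⟩
    refine LinearMap.ext fun x => ?_
    induction x using free_induction with
    | h0 => rw [map_zero, map_zero]
    | hadd x y hx hy => rw [map_add, map_add, hx, hy]
    | hsmul r x hx => rw [map_smul, map_smul, hx]
    | hgen b => rw [h1]; simp [gen, ψ, Term.eval]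
    | hder i x hx =>
      obtain ⟨y, rfl⟩ := Submodule.mkQ_surjective _ x
      rw [h2, hx]
      exact (hder i y).symm
    | hop m x y hx hy =>
      obtain ⟨x, rfl⟩ := Submodule.mkQ_surjective _ x
      obtain ⟨y, rfl⟩ := Submodule.mkQ_surjective _ y
      rw [h3, hx, hy]
      exact (hop m x y).symm

end Free

/-! Words and Gröbner–Shirshov bases, for a constant locality function `N`. -/

/-- The associative word `a₁⟨m₁⟩a₂⟨m₂⟩ ⋯ a_r⟨m_r⟩Dⁱa_{r+1}`: `init` is the list of the pairs
`(a_j, m_j)`, `last = a_{r+1}` and `ind = i`. -/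
structure Word (n : ℕ) (B : Type*) where
  init : List (B × Idx n)
  last : B
  ind : Idx n

namespace Word

variable {n : ℕ} {B : Type*}

/-- Normal words: all the products are below the locality `N`. -/
def IsNormal (N : Idx n) (w : Word n B) : Prop := ∀ x ∈ w.init, Below x.2 N

/-- The length `|w|`, i.e. the number of letters. -/
def length (w : Word n B) : ℕ := w.init.length + 1

/-- Comparison of pairs `(a, m)`: first the letter, then the multi-index, lexicographically. -/
def pairLT [LT B] : B × Idx n → B × Idx n → Prop :=
  Prod.Lex (· < ·) (fun m m' => toLex m < toLex m')

/-- The order of the words: lexicographic order of the weights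
`(|w|, a₁, m₁, …, a_r, m_r, a_{r+1}, i)`. -/
def lt [LT B] (u v : Word n B) : Prop :=
  u.length < v.length ∨ (u.length = v.length ∧
    List.Lex pairLT (u.init ++ [(u.last, u.ind)]) (v.init ++ [(v.last, v.ind)]))

/-- `a⟨m⟩w`, where the possibly empty prefix `a⟨m⟩ = a₁⟨m₁⟩ ⋯ a_r⟨m_r⟩`, with `a` D-free,
is given by the list of the pairs `(a_j, m_j)`. -/
def prepend (L : List (B × Idx n)) (w : Word n B) : Word n B := ⟨L ++ w.init, w.last, w.ind⟩

/-- `w⟨m⟩b`, for a D-free word `w`. -/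
def append (w : Word n B) (m : Idx n) (b : Word n B) : Word n B :=
  ⟨w.init ++ (w.last, m) :: b.init, b.last, b.ind⟩

/-- `wDⁱ`: `Dⁱ` is applied to the last letter. -/
def shift (w : Word n B) (i : Idx n) : Word n B := ⟨w.init, w.last, w.ind + i⟩

end Word

/-- The free associative `n`-conformal algebra on `B` with constant locality `N`. -/
abbrev Conf (k : Type*) [Field k] {n : ℕ} (B : Type*) (N : Idx n) : Type _ :=
  FreeConf k (fun _ _ : B => N)

section GS

variable {k : Type*} [Field k] {n : ℕ} {B : Type*} {N : Idx n}

/-- The right normed product `a₁⟨m₁⟩(a₂⟨m₂⟩( ⋯ (a_r⟨m_r⟩x)))`. -/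
noncomputable def lmul (L : List (B × Idx n)) (x : Conf k B N) : Conf k B N :=
  L.foldr (fun p y => op k p.2 (gen _ p.1) y) x

/-- The element `[w]` obtained from `w` with the right normed bracketing. -/
noncomputable def ev (w : Word n B) : Conf k B N := lmul w.init (derPow k w.ind (gen _ w.last))

/-- `c` is a presentation of `x` as a linear combination of normal words. -/
def Presents (c : Word n B →₀ k) (x : Conf k B N) : Prop :=
  (∀ w ∈ c.support, w.IsNormal N) ∧ x = c.sum fun w r => r • ev w

/-- `w` is the leading associative word of `x`, with coefficient `r`. -/
def HasLead [LT B] (x : Conf k B N) (w : Word n B) (r : k) : Prop :=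
  ∃ c : Word n B →₀ k, Presents c x ∧ c w = r ∧ r ≠ 0 ∧ ∀ u ∈ c.support, u = w ∨ u.lt w

/-- `x` is D-free: all its normal words have index `0`. -/
def IsDFree (x : Conf k B N) : Prop :=
  ∃ c : Word n B →₀ k, Presents c x ∧ ∀ w ∈ c.support, w.ind = 0

/-- Prefixes `a⟨m⟩` with `a` a normal (D-free) word and `m ≺ N`; the empty prefix is allowed. -/
def IsPrefix (N : Idx n) (L : List (B × Idx n)) : Prop := ∀ x ∈ L, Below x.2 N

/-- `y` is a normal `S`-word, with leading associative word `u`: either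
`y = [a⟨m⟩s⟨m'⟩b]` with `s` D-free and `u = a⟨m⟩s̄⟨m'⟩b`, or `y = [a⟨m⟩Dⁱs]` and
`u = a⟨m⟩s̄Dⁱ`.  The prefix `a⟨m⟩` may be empty.  The case of an empty `b` in the first form is the
case `i = 0` of the second one. -/
def IsNormalSWord [LT B] (S : Set (Conf k B N)) (y : Conf k B N) (u : Word n B) : Prop :=
  ∃ s ∈ S, ∃ t : Word n B, HasLead s t 1 ∧ ∃ L : List (B × Idx n), IsPrefix N L ∧
    ((IsDFree s ∧ ∃ (m : Idx n) (b : Word n B), Below m N ∧ b.IsNormal N ∧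
        y = lmul L (op k m s (ev b)) ∧ u = (t.append m b).prepend L) ∨
      (∃ i : Idx n, y = lmul L (derPow k i s) ∧ u = (t.shift i).prepend L))

/-- Triviality of `x = (f, g)_w` modulo `(S, w)`: `x` is a linear combination of normal `S`-words with
leading words `< w`, which moreover are D-free if `dfree` holds. -/
def TrivialBelow [LT B] (S : Set (Conf k B N)) (w : Word n B) (dfree : Prop)
    (x : Conf k B N) : Prop :=
  x ∈ Submodule.span k
    {y | ∃ u, IsNormalSWord S y u ∧ u.lt w ∧ (dfree → IsDFree y)}

/-- Triviality of a composition `x` of left or right multiplication: `x` is a linear combination of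
normal `S`-words with leading words of length at most the one of `x`, which moreover are D-free if
`dfree` holds. -/
def TrivialDeg [LT B] (S : Set (Conf k B N)) (dfree : Prop) (x : Conf k B N) : Prop :=
  x = 0 ∨ ∃ w r, HasLead x w r ∧ x ∈ Submodule.span k
    {y | ∃ u, IsNormalSWord S y u ∧ u.length ≤ w.length ∧ (dfree → IsDFree y)}

/-- `S` is a Gröbner–Shirshov basis: a set of monic polynomials, all the compositions of which are
trivial modulo `S`. -/
structure IsGSBasis [LT B] (S : Set (Conf k B N)) : Prop where
  monic : ∀ s ∈ S, ∃ t, HasLead s t 1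
  /-- Compositions of including, `w = f̄ = u⟨m⟩ḡ⟨m'⟩v`. For an empty `v` this is the case `i = j = 0`
  of right including. -/
  including : ∀ f ∈ S, ∀ g ∈ S, ∀ tf tg : Word n B, HasLead f tf 1 → HasLead g tg 1 → IsDFree g →
    ∀ (L : List (B × Idx n)) (m : Idx n) (v : Word n B), tf = (tg.append m v).prepend L →
      TrivialBelow S tf (IsDFree f ∧ IsDFree g) (f - lmul L (op k m g (ev v)))
  /-- Compositions of right including, `w = f̄Dⁱ = u⟨m⟩ḡDʲ`, where `i` and `j` have disjoint
  supports. -/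
  rightIncluding : ∀ f ∈ S, ∀ g ∈ S, ∀ tf tg : Word n B, HasLead f tf 1 → HasLead g tg 1 →
    ∀ (L : List (B × Idx n)) (i j : Idx n), (∀ l, i l = 0 ∨ j l = 0) →
      tf.shift i = (tg.shift j).prepend L →
      TrivialBelow S (tf.shift i) (IsDFree f ∧ IsDFree g) (derPow k i f - lmul L (derPow k j g))
  /-- Compositions of intersection, `w = f̄⟨m⟩v = u⟨m'⟩ḡ` with `|f̄| + |ḡ| > |w|`. -/
  intersection : ∀ f ∈ S, ∀ g ∈ S, ∀ tf tg : Word n B, HasLead f tf 1 → HasLead g tg 1 → IsDFree f →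
    ∀ (L : List (B × Idx n)) (m : Idx n) (v : Word n B), IsPrefix N L → Below m N → v.IsNormal N →
      tf.append m v = tg.prepend L → (tf.append m v).length < tf.length + tg.length →
      TrivialBelow S (tf.append m v) (IsDFree f ∧ IsDFree g) (op k m f (ev v) - lmul L g)
  /-- Compositions of left multiplication. -/
  leftMul : ∀ f ∈ S, ∀ (a : B) (m : Idx n), ¬ Below m N →
    TrivialDeg S (IsDFree f) (op k m (gen _ a) f)
  /-- Compositions of right multiplication. -/
  rightMul : ∀ f ∈ S, ¬ IsDFree f → ∀ (a : B) (m : Idx n),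
    TrivialDeg S True (op k m f (gen _ a))

/-- `S`-irreducible normal words: neither of the form `a⟨m⟩s̄⟨m'⟩b` with `s ∈ S` D-free, nor of the
form `a⟨m⟩s̄Dⁱ` with `s ∈ S`, the parts `a⟨m⟩` and `⟨m'⟩b` being possibly empty. -/
def IsIrreducible [LT B] (S : Set (Conf k B N)) (w : Word n B) : Prop :=
  w.IsNormal N ∧ ∀ s ∈ S, ∀ (t : Word n B) (r : k), HasLead s t r → ∀ L : List (B × Idx n),
    (IsDFree s → ∀ (m : Idx n) (b : Word n B), w ≠ (t.append m b).prepend L) ∧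
    ∀ i : Idx n, w ≠ (t.shift i).prepend L

end GS

/-- The alternating list `[x, y, x, y, …]` with `r` entries. -/
def alternating {α : Type*} (x y : α) : ℕ → List α
  | 0 => []
  | r + 1 => x :: alternating y x r

/-- The words `a⟨m₁⟩a ⋯ a⟨m_r⟩Dⁱa` in which `(m₁, …, m_r)` is a possibly empty alternating sequence of
`(1,0)` and `(0,1)`, possibly followed by one final `(1,1)`. -/
def IsListed (w : Word 2 Unit) : Prop :=
  ∃ (r : ℕ) (e : List (Idx 2)), (e = [] ∨ e = [![1, 1]]) ∧
    (w.init.map Prod.snd = alternating ![1, 0] ![0, 1] r ++ e ∨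
      w.init.map Prod.snd = alternating ![0, 1] ![1, 0] r ++ e)

end NConformal

/-! No composition is computed explicitly. The leading words of `S` form a list of forbidden
patterns, and the normal words avoiding them are exactly the listed ones. Any other normal word is
the leading word of a normal `S`-word, so well-founded reduction writes every element as a
combination of normal `S`-words plus a combination of listed words, with bounds on the leading words
(`IsPatternSystem.mem_sup`). Suppose the listed words are independent modulo the ideal `I` of `f`.
Then the listed part of an element of `I` vanishes (`IsPatternSystem.mem_span`). All compositions
lie in `I`, so they are all trivial. The same independence, together with the reduction, gives the
basis of the quotient.

Three facts remain. First, `S ⊆ I`: locality of `a` turns associativity into linear relations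
between the elements `a⟨m⟩a⟨p⟩a`, and `f` kills modulo `I` those with `p = 0` and `m` outside the
locality (`consequences_mem`). Second, normal words are independent in `C`, so that leading words
are well defined (`linearIndependent_ev`). Third, listed words are independent modulo `I`
(`exists_ideal`).

The last two use representations. Sequences in an associative algebra carry products `⟨m⟩` that
satisfy every identity except locality. Let `X`, `d₁`, `d₂` be operators with `d₁d₂ = d₂d₁` and
`[dᵢ,[dᵢ,X]] = 0`. Then `n ↦ X dⁿ` is local of order `(2,2)` with itself, so `a ↦ (X dⁿ)` extends to
`C`. On a vector `v` killed by `d₁`, `d₂`, the top value of a normal word is a nonzero multiple of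
`X d^{m₁} X ⋯ X d^{m_r} X v`, at the index of its last letter. Independence of words thus reduces to
independence of such vectors (`linearIndependent_of_wordVal`).

For `C`, `X` is multiplication by a letter, the derivations replace letters by larger ones, and the
vectors are triangular for the lexicographic order. For the quotient, `X` is multiplication by an
idempotent `a` with `∂ᵢa = bᵢ`. The anticommutator `b₁b₂ + b₂b₁` is a free central variable, so
alternating products of the `bᵢ` of all lengths stay independent. -/

namespace NConformal

/-! ### The order of the words. -/

namespace Word

variable {n : ℕ} {B : Type*}

/-- A letter with its multi-index, as an element of the lexicographic product. -/
def pairKey (p : B × Idx n) : B ×ₗ Lex (Idx n) := toLex (p.1, toLex p.2)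

/-- The weight of a word, as an element of a linear order. -/
def key (w : Word n B) : ℕ ×ₗ List (B ×ₗ Lex (Idx n)) :=
  toLex (w.length, (w.init ++ [(w.last, w.ind)]).map pairKey)

theorem pairKey_injective : Function.Injective (pairKey : B × Idx n → _) := by
  rintro ⟨b, m⟩ ⟨b', m'⟩ h
  simpa [pairKey] using h

theorem key_injective : Function.Injective (key : Word n B → _) := by
  rintro ⟨l, b, i⟩ ⟨l', b', i'⟩ h
  have h2 := congrArg (fun x => (ofLex x).2) h
  have h3 := (List.map_injective_iff.2 pairKey_injective) h2
  obtain ⟨h4, h5⟩ := List.append_inj' h3 rfl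
  simp only [List.cons.injEq, Prod.mk.injEq, and_true] at h5
  simp only [Word.mk.injEq]
  exact ⟨h4, h5⟩

section Order

variable [LinearOrder B]

theorem pairLT_iff {p q : B × Idx n} : pairLT p q ↔ pairKey p < pairKey q := by
  rw [pairLT, Prod.lex_def, pairKey, pairKey, Prod.Lex.toLex_lt_toLex]

theorem lex_iff : ∀ {l l' : List (B × Idx n)},
    List.Lex pairLT l l' ↔ List.Lex (· < ·) (l.map pairKey) (l'.map pairKey)
  | [], [] => by simp
  | [], _ :: _ => by simp
  | _ :: _, [] => by simp
  | p :: l, q :: l' => by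
    rw [List.map_cons, List.map_cons, List.cons_lex_cons_iff, List.cons_lex_cons_iff, lex_iff,
      pairLT_iff, pairKey_injective.eq_iff]

theorem lt_iff_key {u v : Word n B} : u.lt v ↔ u.key < v.key := by
  rw [lt, key, key, Prod.Lex.toLex_lt_toLex, lex_iff]
  exact Iff.rfl

theorem lt_trans {u v w : Word n B} (h : u.lt v) (h' : v.lt w) : u.lt w := by
  rw [lt_iff_key] at *
  exact h.trans h'

theorem lt_irrefl (u : Word n B) : ¬ u.lt u := by
  rw [lt_iff_key]
  exact _root_.lt_irrefl _

/-- Plain lexicographic order on lists is not well founded. Comparing lengths first makes this a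
shortlex order over the well-founded order of pairs. -/
theorem lt_wf [WellFoundedLT B] : WellFounded (lt : Word n B → Word n B → Prop) := by
  have h1 : WellFounded (pairLT : B × Idx n → B × Idx n → Prop) :=
    Subrelation.wf (fun h => pairLT_iff.1 h)
      (InvImage.wf pairKey (wellFounded_lt (α := B ×ₗ Lex (Idx n))))
  refine Subrelation.wf (fun {u v} h => ?_)
    (InvImage.wf (fun w : Word n B => w.init ++ [(w.last, w.ind)]) (List.Shortlex.wf h1))
  simpa [InvImage, List.shortlex_def, lt, length] using h

/-- A nonempty finite set of words has a greatest element. -/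
theorem exists_greatest {s : Finset (Word n B)} (hs : s.Nonempty) :
    ∃ w ∈ s, ∀ u ∈ s, u = w ∨ u.lt w := by
  obtain ⟨w, hw, h⟩ := s.exists_max_image key hs
  refine ⟨w, hw, fun u hu => ?_⟩
  rcases (h u hu).lt_or_eq with h | h
  · exact Or.inr (lt_iff_key.2 h)
  · exact Or.inl (key_injective h)

theorem lt_prepend {u v : Word n B} (h : u.lt v) (L : List (B × Idx n)) :
    (u.prepend L).lt (v.prepend L) := by
  simp only [lt, length, prepend, List.append_assoc, List.length_append] at *
  rcases h with h | ⟨h, h'⟩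
  · left; omega
  · exact Or.inr ⟨by omega, List.Lex.append_left _ h' _⟩

theorem lt_prepend_cons {u v : Word n B} (h : u.length = v.length) (b : B) {m m' : Idx n}
    (hm : toLex m < toLex m') : (u.prepend [(b, m)]).lt (v.prepend [(b, m')]) := by
  simp only [lt, length, prepend, List.length_append, List.length_singleton] at *
  refine Or.inr ⟨by omega, List.Lex.rel (Prod.Lex.right _ hm)⟩

theorem lt_of_length_lt {u v : Word n B} (h : u.length < v.length) : u.lt v := Or.inl h

theorem lt_length_le {u v : Word n B} (h : u.lt v) : u.length ≤ v.length := by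
  rcases h with h | ⟨h, -⟩ <;> omega

/-- Words of equal length have their last letters face to face, and the lexicographic order of
multi-indices is invariant under translation. -/
theorem lt_shift {u v : Word n B} (h : u.lt v) (i : Idx n) : (u.shift i).lt (v.shift i) := by
  have key : ∀ (l l' : List (B × Idx n)) (b b' : B) (j j' : Idx n), l.length = l'.length →
      List.Lex pairLT (l ++ [(b, j)]) (l' ++ [(b', j')]) →
      List.Lex pairLT (l ++ [(b, j + i)]) (l' ++ [(b', j' + i)]) := by
    intro l
    induction l with
    | nil =>
      rintro (_ | ⟨q, l'⟩) b b' j j' hl h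
      · simp only [List.nil_append, List.lex_singleton_iff, pairLT, Prod.lex_def] at h ⊢
        refine h.imp_right (fun h => ⟨h.1, ?_⟩)
        obtain ⟨c, hc, hc'⟩ := h.2
        exact ⟨c, fun d hd => congrArg (· + i d) (hc d hd), Nat.add_lt_add_right hc' (i c)⟩
      · simp at hl
    | cons p l ih =>
      rintro (_ | ⟨q, l'⟩) b b' j j' hl h
      · simp at hl
      · rw [List.cons_append, List.cons_append, List.cons_lex_cons_iff] at h ⊢
        exact h.imp_right fun h => ⟨h.1, ih _ _ _ _ _ (by simpa using hl) h.2⟩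
  simp only [lt, length, shift] at *
  exact h.imp_right fun h => ⟨h.1, key _ _ _ _ _ _ (by omega) h.2⟩

end Order

theorem toLex_sub_lt {m s : Idx n} (hs : s ≤ m) (h : s ≠ 0) : toLex (m - s) < toLex m := by
  refine Pi.toLex_strictMono (lt_of_le_of_ne (fun i => Nat.sub_le _ _) fun h' => h ?_)
  funext i
  have h1 := congrFun h' i
  have h2 := hs i
  simp only [Pi.sub_apply, Pi.zero_apply] at *
  omega

end Word

/-! ### Multi-indices and powers of the derivations. -/

section Basics

variable {k : Type*} [Field k] {n : ℕ}

theorem coeff_zero (m : Idx n) : coeff k m 0 = 1 := by simp [coeff]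

theorem zero_mem_Iic (m : Idx n) : (0 : Idx n) ∈ Finset.Iic m :=
  Finset.mem_Iic.2 fun _ => Nat.zero_le _

/-- The product is an ordered one in a noncommutative monoid; commutation brings the extra factor `d
j` to the front. -/
theorem prod_ofFn_pow_add_single {G : Type*} [Monoid G] : ∀ {n : ℕ} (d : Fin n → G)
    (_ : ∀ a b, Commute (d a) (d b)) (i : Idx n) (j : Fin n),
    (List.ofFn fun l => d l ^ (i + Pi.single j 1 : Idx n) l).prod
      = d j * (List.ofFn fun l => d l ^ i l).prod
  | 0, _, _, _, j => j.elim0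
  | n + 1, d, hd, i, j => by
    rw [List.ofFn_succ, List.ofFn_succ, List.prod_cons, List.prod_cons]
    cases j using Fin.cases with
    | zero => simp [pow_succ', mul_assoc]
    | succ j =>
      have h := prod_ofFn_pow_add_single (fun l => d l.succ) (fun a b => hd _ _)
        (fun l => i l.succ) j
      have h2 : ∀ l : Fin n, (i + Pi.single j.succ 1 : Idx (n + 1)) l.succ
          = ((fun l => i l.succ) + Pi.single j 1 : Idx n) l := by
        intro l
        simp [Pi.single_apply]
      simp only [h2, h]
      rw [← mul_assoc, ← mul_assoc]
      congr 1
      simpa using ((hd 0 j.succ).pow_left (i 0)).eq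

theorem idx_induction {P : Idx n → Prop} (h0 : P 0)
    (hs : ∀ (i : Idx n) (j : Fin n), P i → P (i + Pi.single j 1)) (i : Idx n) : P i := by
  induction h : ∑ l, i l generalizing i with
  | zero =>
    have : i = 0 := by
      funext l
      simpa using (Finset.sum_eq_zero_iff.1 h) l (Finset.mem_univ l)
    exact this ▸ h0
  | succ d ih =>
    obtain ⟨j, hj⟩ : ∃ j, i j ≠ 0 := by
      by_contra! h'
      simp [h'] at h
    have h1 : i - Pi.single j 1 + Pi.single j 1 = i := by
      funext l
      rcases eq_or_ne l j with rfl | hl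
      · simp only [Pi.add_apply, Pi.sub_apply, Pi.single_eq_same]; omega
      · simp [hl]
    rw [← h1]
    refine hs _ j (ih _ ?_)
    have h2 := congrArg (fun f => ∑ l, f l) h1
    simp only [Pi.add_apply, Finset.sum_add_distrib, Finset.sum_pi_single', Finset.mem_univ,
      if_true] at h2
    rw [h] at h2
    exact Nat.succ_injective h2

section Derivations

variable {M : Type*} [AddCommGroup M] [Module k M] [ConformalOps k n M]

theorem derPow_zero (x : M) : derPow k (0 : Idx n) x = x := by
  simp [derPow]

theorem derPow_add_single [IsAssocConformal k n M] (i : Idx n) (j : Fin n) (x : M) :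
    derPow k (i + Pi.single j 1) x = der k j (derPow k i x) := by
  have h := prod_ofFn_pow_add_single (fun j : Fin n => (der k j : Module.End k M))
    (fun a b => LinearMap.ext fun x => IsAssocConformal.der_comm a b x) i j
  exact LinearMap.congr_fun h x

end Derivations

end Basics

/-! ### Normal words span, with control of the length and of D-freeness. -/

section Span

variable (k : Type*) [Field k] {n : ℕ} {B : Type*} (N : Idx n)

/-- The span of the normal words with the property `P`. -/
noncomputable def wordSpan (P : Word n B → Prop) : Submodule k (Conf k B N) :=
  Submodule.span k (ev '' {w | w.IsNormal N ∧ P w})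

variable {k N}

theorem ev_mem_wordSpan {P : Word n B → Prop} {w : Word n B} (hw : w.IsNormal N) (h : P w) :
    (ev w : Conf k B N) ∈ wordSpan k N P :=
  Submodule.subset_span ⟨w, ⟨hw, h⟩, rfl⟩

theorem wordSpan_le {P : Word n B → Prop} {X : Submodule k (Conf k B N)}
    (h : ∀ w : Word n B, w.IsNormal N → P w → ev w ∈ X) : wordSpan k N P ≤ X := by
  refine Submodule.span_le.2 ?_
  rintro _ ⟨w, ⟨h1, h2⟩, rfl⟩
  exact h w h1 h2

theorem wordSpan_mono {P Q : Word n B → Prop} (h : ∀ w, w.IsNormal N → P w → Q w) :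
    wordSpan k N P ≤ wordSpan k N Q :=
  wordSpan_le fun w h1 h2 => ev_mem_wordSpan h1 (h w h1 h2)

theorem map_mem_of_wordSpan {P : Word n B → Prop} {X : Submodule k (Conf k B N)}
    (φ : Conf k B N →ₗ[k] Conf k B N) (h : ∀ w : Word n B, w.IsNormal N → P w → φ (ev w) ∈ X)
    {x : Conf k B N} (hx : x ∈ wordSpan k N P) : φ x ∈ X :=
  wordSpan_le (X := X.comap φ) h hx

theorem isNormal_prepend {L : List (B × Idx n)} {w : Word n B} :
    (w.prepend L).IsNormal N ↔ IsPrefix N L ∧ w.IsNormal N := by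
  simp only [Word.IsNormal, Word.prepend, IsPrefix, List.mem_append]
  exact ⟨fun h => ⟨fun x hx => h x (Or.inl hx), fun x hx => h x (Or.inr hx)⟩,
    fun h x hx => hx.elim (h.1 x) (h.2 x)⟩

theorem isNormal_append {w b : Word n B} {m : Idx n} :
    (w.append m b).IsNormal N ↔ w.IsNormal N ∧ Below m N ∧ b.IsNormal N := by
  simp only [Word.IsNormal, Word.append, List.mem_append, List.mem_cons]
  exact ⟨fun h => ⟨fun x hx => h x (Or.inl hx), h (w.last, m) (Or.inr (Or.inl rfl)),
    fun x hx => h x (Or.inr (Or.inr hx))⟩,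
    fun h x hx => by
      rcases hx with hx | rfl | hx
      exacts [h.1 x hx, h.2.1, h.2.2 x hx]⟩

theorem ev_prepend (L : List (B × Idx n)) (w : Word n B) :
    (ev (w.prepend L) : Conf k B N) = lmul L (ev w) := by
  simp [ev, lmul, Word.prepend]

theorem lmul_cons (b : B) (m : Idx n) (L : List (B × Idx n)) (x : Conf k B N) :
    lmul ((b, m) :: L) x = op k m (gen _ b) (lmul L x) := rfl

/-- `lmul L` as a linear map. -/
noncomputable def lmulₗ (L : List (B × Idx n)) : Conf k B N →ₗ[k] Conf k B N :=
  L.foldr (fun p φ => (op k p.2 (gen _ p.1)).comp φ) LinearMap.id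

theorem lmulₗ_apply (L : List (B × Idx n)) (x : Conf k B N) : lmulₗ L x = lmul L x := by
  induction L with
  | nil => rfl
  | cons p L ih => rw [lmul_cons, ← ih]; rfl

theorem lmul_sub (L : List (B × Idx n)) (x y : Conf k B N) :
    lmul L (x - y) = lmul L x - lmul L y := by
  simp only [← lmulₗ_apply, map_sub]

/-- By Leibniz, `Dⱼ` either lowers one of the multi-indices, which keeps the word normal, or moves
on to the last letter. -/
theorem der_mem_wordSpan (j : Fin n) {l : ℕ} {x : Conf k B N}
    (hx : x ∈ wordSpan k N fun w => w.length = l) :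
    der k j x ∈ wordSpan k N fun w => w.length = l := by
  refine map_mem_of_wordSpan (der k j) ?_ hx
  rintro ⟨L, b, i⟩ hw hl
  clear hx
  induction L generalizing l with
  | nil =>
    have : (der k j (ev ⟨[], b, i⟩) : Conf k B N) = ev ⟨[], b, i + Pi.single j 1⟩ := by
      simp only [ev, lmul, List.foldr_nil, derPow_add_single]
    rw [this]
    exact ev_mem_wordSpan hw hl
  | cons p L ih =>
    obtain ⟨c, m⟩ := p
    have hm : Below m N := hw (c, m) (by simp)
    have hw' : Word.IsNormal N ⟨L, b, i⟩ := fun x hx => hw x (List.mem_cons_of_mem _ hx)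
    obtain ⟨l, rfl⟩ : ∃ l', l = l' + 1 := ⟨L.length + 1, by simpa [Word.length] using hl.symm⟩
    have hl' : Word.length ⟨L, b, i⟩ = l := by simpa [Word.length] using hl
    have hev : (ev ⟨(c, m) :: L, b, i⟩ : Conf k B N) = op k m (gen _ c) (ev ⟨L, b, i⟩) := rfl
    rw [hev, free_leibniz, free_der_op]
    refine add_mem (neg_mem (Submodule.smul_mem _ _ ?_)) ?_
    · refine ev_mem_wordSpan (w := Word.prepend [(c, m - Pi.single j 1)] ⟨L, b, i⟩)
        (isNormal_prepend.2 ⟨?_, hw'⟩) ?_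
      · intro x hx
        rw [List.mem_singleton.1 hx]
        exact fun l => lt_of_le_of_lt (Nat.sub_le _ _) (hm l)
      · simp [Word.length, Word.prepend] at hl' ⊢; omega
    · refine map_mem_of_wordSpan (op k m (gen _ c)) ?_ (ih hw' hl')
      intro w hw hl
      refine ev_mem_wordSpan (w := w.prepend [(c, m)]) (isNormal_prepend.2 ⟨?_, hw⟩) ?_
      · intro x hx
        rw [List.mem_singleton.1 hx]
        exact hm
      · simp [Word.length, Word.prepend] at hl ⊢; omega

/-- Induction on the length, and inside it on the total degree of `m`. A product outside the
locality is rewritten by associativity into products with smaller left index. The flag `d` allows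
one proof for the D-free and the general statement. -/
theorem op_gen_mem_wordSpan (d : Prop) (b : B) (m : Idx n) {l : ℕ} {x : Conf k B N}
    (hx : x ∈ wordSpan k N fun w => w.length = l ∧ (d → w.ind = 0)) :
    op k m (gen _ b) x ∈ wordSpan k N fun w => w.length = l + 1 ∧ (d → w.ind = 0) := by
  induction l generalizing b m x with
  | zero =>
    refine map_mem_of_wordSpan (op k m (gen _ b)) ?_ hx
    rintro w - ⟨h, -⟩
    simp [Word.length] at h
  | succ l ih =>
    induction h : ∑ i, m i using Nat.strong_induction_on generalizing m b x with
    | _ t iht =>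
    refine map_mem_of_wordSpan (op k m (gen _ b)) ?_ hx
    rintro w hw ⟨hl, hd⟩
    by_cases hm : Below m N
    · refine ev_mem_wordSpan (w := w.prepend [(b, m)])
        (isNormal_prepend.2 ⟨by simpa [IsPrefix] using hm, hw⟩) ⟨?_, hd⟩
      simp [Word.length, Word.prepend] at hl ⊢; omega
    obtain ⟨_ | ⟨⟨c, p⟩, L⟩, e, i⟩ := w
    · simp only [Word.length, List.length_nil, zero_add, right_eq_add] at hl hd
      obtain rfl : l = 0 := by omega
      by_cases hi : i = 0
      · subst hi
        have h0 : op k m (gen _ b : Conf k B N) (gen _ e) = 0 := free_gen_local _ b e m hm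
        have : op k m (gen _ b : Conf k B N) (ev ⟨[], e, 0⟩) = 0 := by
          simpa [ev, lmul, derPow_zero] using h0
        rw [this]
        exact zero_mem _
      · have hd' : ¬ d := fun h => hi (hd h)
        simp only [hd', false_imp_iff, and_true]
        -- Leibniz gives `b⟨m⟩Dⱼx = Dⱼ(b⟨m⟩x) - (Dⱼb)⟨m⟩x`. The last term involves `m - eⱼ`, hence
        -- the induction on `i` for all `m` at once.
        have key : ∀ (i m : Idx n), op k m (gen _ b : Conf k B N) (derPow k i (gen _ e)) ∈
            wordSpan k N fun w => w.length = 0 + 1 + 1 := by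
          intro i
          induction i using idx_induction with
          | h0 =>
            intro m
            rw [derPow_zero]
            by_cases hm : Below m N
            · have := ev_mem_wordSpan (k := k) (P := fun w => w.length = 0 + 1 + 1)
                (w := Word.prepend [(b, m)] ⟨[], e, 0⟩) (N := N) (isNormal_prepend.2
                  ⟨by simpa [IsPrefix] using hm, by simp [Word.IsNormal]⟩) (by simp [Word.length, Word.prepend])
              rw [ev_prepend] at this
              simpa [lmul, ev, derPow_zero] using this
            · rw [free_gen_local _ b e m hm]
              exact zero_mem _
          | hs i j ih =>
            intro m
            have h1 := free_leibniz (fun _ _ : B => N) j m (gen _ b : Conf k B N)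
              (derPow k i (gen _ e))
            rw [derPow_add_single, ← sub_eq_iff_eq_add'.2 h1, free_der_op]
            exact sub_mem (der_mem_wordSpan j (ih m))
              (neg_mem (Submodule.smul_mem _ _ (ih _)))
        exact key i m
    · have hw' : Word.IsNormal N ⟨L, e, i⟩ := fun x hx => hw x (List.mem_cons_of_mem _ hx)
      have hl' : Word.length ⟨L, e, i⟩ = l := by
        simp [Word.length] at hl ⊢; omega
      have hev : (ev ⟨(c, p) :: L, e, i⟩ : Conf k B N) = op k p (gen _ c) (ev ⟨L, e, i⟩) := rfl
      -- The left side of associativity contains `b⟨m⟩c = 0`. On the right, `s = 0` is the wanted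
      -- product and the other terms have left index `m - s` of smaller degree.
      have hA := free_assoc (fun _ _ : B => N) m p (gen _ b : Conf k B N) (gen _ c)
        (ev ⟨L, e, i⟩)
      rw [free_gen_local _ b c m hm, map_zero, LinearMap.zero_apply,
        ← Finset.add_sum_erase _ _ (zero_mem_Iic _), coeff_zero, one_smul,
        tsub_zero, add_zero, ← hev] at hA
      rw [eq_neg_of_add_eq_zero_left hA.symm]
      refine neg_mem (Submodule.sum_mem _ fun s hs => Submodule.smul_mem _ _ ?_)
      obtain ⟨hs0, hs⟩ := Finset.mem_erase.1 hs
      have hsm : s ≤ m := Finset.mem_Iic.1 hs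
      refine iht (∑ i, (m - s) i) ?_ b (m - s)
        (ih c (p + s) (ev_mem_wordSpan hw' ⟨hl', hd⟩)) rfl
      rw [← h]
      obtain ⟨j, hj⟩ := Function.ne_iff.1 hs0
      refine Finset.sum_lt_sum (fun i _ => Nat.sub_le _ _) ⟨j, Finset.mem_univ _, ?_⟩
      have := hsm j
      simp only [Pi.sub_apply, Pi.zero_apply] at *
      omega

/-- Associativity peels off the letters of the left factor one by one. Derivations on its last
letter become scalars and lower `m`, so only the index of the right factor matters for D-freeness.
-/
theorem op_ev_mem_wordSpan (d : Prop) (w : Word n B) (m : Idx n) {l : ℕ} {x : Conf k B N}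
    (hx : x ∈ wordSpan k N fun w => w.length = l ∧ (d → w.ind = 0)) :
    op k m (ev w) x ∈ wordSpan k N fun u => u.length = w.length + l ∧ (d → u.ind = 0) := by
  obtain ⟨L, b, i⟩ := w
  induction L generalizing m x l with
  | nil =>
    have hev : (ev ⟨[], b, i⟩ : Conf k B N) = derPow k i (gen _ b) := rfl
    rw [hev]
    have : Word.length ⟨[], b, i⟩ + l = l + 1 := by simp [Word.length, add_comm]
    rw [this]
    clear hev this
    induction i using idx_induction generalizing m with
    | h0 => rw [derPow_zero]; exact op_gen_mem_wordSpan d b m hx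
    | hs i j ih =>
      rw [derPow_add_single, free_der_op]
      exact neg_mem (Submodule.smul_mem _ _ (ih _))
  | cons p L ih =>
    obtain ⟨c, p⟩ := p
    have hev : (ev ⟨(c, p) :: L, b, i⟩ : Conf k B N) = op k p (gen _ c) (ev ⟨L, b, i⟩) := rfl
    rw [hev, free_assoc]
    refine Submodule.sum_mem _ fun s hs => Submodule.smul_mem _ _ ?_
    have := op_gen_mem_wordSpan d c (p - s) (ih (m + s) hx)
    have hl : Word.length ⟨(c, p) :: L, b, i⟩ + l = Word.length ⟨L, b, i⟩ + l + 1 := by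
      simp [Word.length]; omega
    rwa [hl]

/-- The normal words span the free associative conformal algebra. -/
theorem wordSpan_true : wordSpan k N (fun _ : Word n B => True) = ⊤ := by
  refine eq_top_iff.2 fun x _ => ?_
  induction x using free_induction with
  | h0 => exact zero_mem _
  | hadd x y hx hy => exact add_mem (hx trivial) (hy trivial)
  | hsmul r x hx => exact Submodule.smul_mem _ _ (hx trivial)
  | hgen b =>
    have := ev_mem_wordSpan (k := k) (N := N) (w := ⟨[], b, 0⟩) (P := fun _ => True)
      (by simp [Word.IsNormal]) trivial
    simpa [ev, lmul, derPow_zero] using this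
  | hder i x hx =>
    refine map_mem_of_wordSpan (der k i) (fun w hw _ => ?_) (hx trivial)
    exact wordSpan_mono (fun _ _ _ => trivial)
      (der_mem_wordSpan i (ev_mem_wordSpan (P := fun u => u.length = w.length) hw rfl))
  | hop m x y hx hy =>
    refine map_mem_of_wordSpan (op k m x) (fun w hw _ => ?_) (hy trivial)
    refine map_mem_of_wordSpan ((op k m).flip (ev w)) (fun u hu _ => ?_) (hx trivial)
    exact wordSpan_mono (fun _ _ _ => trivial) (op_ev_mem_wordSpan False u m
      (ev_mem_wordSpan (P := fun u => u.length = w.length ∧ (False → u.ind = 0)) hw ⟨rfl, False.elim⟩))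

end Span

/-! ### Leading words of derivatives and products. -/

section Leading

variable {k : Type*} [Field k] {n : ℕ} {B : Type*} [LinearOrder B] {N : Idx n}

theorem lmul_mem_wordSpan_lt {L : List (B × Idx n)} (hL : IsPrefix N L) {w : Word n B}
    {x : Conf k B N} {d : Prop}
    (hx : x ∈ wordSpan k N fun u => u.lt w ∧ (d → u.ind = 0)) :
    lmul L x ∈ wordSpan k N fun u => u.lt (w.prepend L) ∧ (d → u.ind = 0) := by
  rw [← lmulₗ_apply]
  refine map_mem_of_wordSpan (lmulₗ L) (fun u hu h => ?_) hx
  rw [lmulₗ_apply, ← ev_prepend]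
  exact ev_mem_wordSpan (isNormal_prepend.2 ⟨hL, hu⟩) ⟨Word.lt_prepend h.1 L, h.2⟩

/-- The leading word of `Dⱼ[w]` is `wDⱼ`. -/
theorem der_ev_sub_mem (j : Fin n) {w : Word n B} (hw : w.IsNormal N) :
    der k j (ev w : Conf k B N) - ev (w.shift (Pi.single j 1)) ∈
      wordSpan k N fun u => u.lt (w.shift (Pi.single j 1)) := by
  obtain ⟨L, b, i⟩ := w
  induction L with
  | nil =>
    have : (der k j (ev ⟨[], b, i⟩) : Conf k B N) = ev (Word.shift ⟨[], b, i⟩ (Pi.single j 1)) := by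
      simp only [ev, lmul, List.foldr_nil, Word.shift, derPow_add_single]
    rw [this, sub_self]
    exact zero_mem _
  | cons p L ih =>
    obtain ⟨c, m⟩ := p
    have hm : Below m N := hw (c, m) (by simp)
    have hw' : Word.IsNormal N ⟨L, b, i⟩ := fun x hx => hw x (List.mem_cons_of_mem _ hx)
    have hev : (ev ⟨(c, m) :: L, b, i⟩ : Conf k B N) = op k m (gen _ c) (ev ⟨L, b, i⟩) := rfl
    have hev' : (ev (Word.shift ⟨(c, m) :: L, b, i⟩ (Pi.single j 1)) : Conf k B N)
      = op k m (gen _ c) (ev (Word.shift ⟨L, b, i⟩ (Pi.single j 1))) := rfl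
    rw [hev, hev', free_leibniz, free_der_op, add_sub_assoc, ← map_sub]
    refine add_mem (neg_mem ?_) ?_
    -- If `m j = 0`, truncated subtraction leaves `m` unchanged, but the coefficient vanishes.
    -- Otherwise the first multi-index drops, which makes the word smaller.
    · rcases Nat.eq_zero_or_pos (m j) with h0 | h0
      · rw [h0, Nat.cast_zero, zero_smul]
        exact zero_mem _
      refine Submodule.smul_mem _ _ (ev_mem_wordSpan
        (w := Word.prepend [(c, m - Pi.single j 1)] ⟨L, b, i⟩) (isNormal_prepend.2 ⟨?_, hw'⟩) ?_)
      · intro x hx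
        rw [List.mem_singleton.1 hx]
        exact fun l => lt_of_le_of_lt (Nat.sub_le _ _) (hm l)
      · exact Word.lt_prepend_cons (u := ⟨L, b, i⟩) (v := Word.shift ⟨L, b, i⟩ (Pi.single j 1)) rfl c
          (Word.toLex_sub_lt (fun l => by
            rcases eq_or_ne l j with rfl | hl
            · simpa using Nat.succ_le_of_lt h0
            · simp [hl]) (by simp))
    · have := lmul_mem_wordSpan_lt (k := k) (N := N) (d := False) (L := [(c, m)])
        (by simpa [IsPrefix] using hm) (wordSpan_mono (fun _ _ h => ⟨h, False.elim⟩) (ih hw'))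
      exact wordSpan_mono (fun _ _ h => h.1) this

theorem der_mem_wordSpan_lt (j : Fin n) {w : Word n B} {x : Conf k B N}
    (hx : x ∈ wordSpan k N fun u => u.lt w) :
    der k j x ∈ wordSpan k N fun u => u.lt (w.shift (Pi.single j 1)) := by
  refine map_mem_of_wordSpan (der k j) (fun u hu h => ?_) hx
  rw [← sub_add_cancel (der k j (ev u)) (ev (u.shift (Pi.single j 1)))]
  have h' := Word.lt_shift h (Pi.single j 1)
  exact add_mem (wordSpan_mono (fun v _ hv => Word.lt_trans hv h') (der_ev_sub_mem j hu))
    (ev_mem_wordSpan hu h')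

/-- The leading word of `Dⁱx` is `wDⁱ` if `w` is the leading word of `x`. -/
theorem derPow_sub_mem (i : Idx n) {w : Word n B} (hw : w.IsNormal N) {x : Conf k B N}
    (hx : x - ev w ∈ wordSpan k N fun u => u.lt w) :
    derPow k i x - ev (w.shift i) ∈ wordSpan k N fun u => u.lt (w.shift i) := by
  induction i using idx_induction with
  | h0 => simpa [derPow_zero, Word.shift] using hx
  | hs i j ih =>
    have h1 := der_mem_wordSpan_lt j ih
    have h2 := der_ev_sub_mem (k := k) j (w := w.shift i) hw
    have h3 : (w.shift i).shift (Pi.single j 1) = w.shift (i + Pi.single j 1) := by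
      simp [Word.shift, add_assoc]
    rw [h3] at h1 h2
    rw [derPow_add_single]
    simpa using add_mem h1 h2

/-- The leading word of `[t]⟨m⟩[b]`, for a D-free word `t`, is `t⟨m⟩b`. -/
theorem op_ev_sub_mem (d : Prop) {t b : Word n B} (ht : t.IsNormal N) (ht0 : t.ind = 0) {m : Idx n}
    (hb : b.IsNormal N) (hd : d → b.ind = 0) :
    op k m (ev t : Conf k B N) (ev b) - ev (t.append m b) ∈
      wordSpan k N fun u => u.lt (t.append m b) ∧ (d → u.ind = 0) := by
  obtain ⟨L, c, i⟩ := t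
  obtain rfl : i = 0 := ht0
  induction L with
  | nil =>
    have : op k m (ev ⟨[], c, 0⟩ : Conf k B N) (ev b) = ev (Word.append ⟨[], c, 0⟩ m b) := by
      simp [ev, lmul, derPow_zero, Word.append]
    rw [this, sub_self]
    exact zero_mem _
  | cons p L ih =>
    obtain ⟨a, p⟩ := p
    have hp : Below p N := ht (a, p) (by simp)
    have ht' : Word.IsNormal N ⟨L, c, 0⟩ := fun x hx => ht x (List.mem_cons_of_mem _ hx)
    have hev : (ev ⟨(a, p) :: L, c, 0⟩ : Conf k B N) = op k p (gen _ a) (ev ⟨L, c, 0⟩) := rfl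
    have hev' : (ev (Word.append ⟨(a, p) :: L, c, 0⟩ m b) : Conf k B N)
      = op k p (gen _ a) (ev (Word.append ⟨L, c, 0⟩ m b)) := rfl
    have hw : Word.append ⟨(a, p) :: L, c, 0⟩ m b
      = (Word.append ⟨L, c, 0⟩ m b).prepend [(a, p)] := rfl
    -- The term `s = 0` carries the leading word. The other terms begin with `a⟨p - s⟩`, so they are
    -- smaller whatever follows.
    have hA := free_assoc (fun _ _ : B => N) p m (gen _ a : Conf k B N) (ev ⟨L, c, 0⟩) (ev b)
    rw [← Finset.add_sum_erase _ _ (zero_mem_Iic _), coeff_zero, one_smul, tsub_zero,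
      add_zero] at hA
    rw [hev, hev', hA, add_sub_right_comm]
    refine add_mem ?_ (Submodule.sum_mem _ fun s hs => Submodule.smul_mem _ _ ?_)
    · rw [← map_sub, hw]
      exact lmul_mem_wordSpan_lt (L := [(a, p)]) (by simpa [IsPrefix] using hp) (ih ht')
    · obtain ⟨hs0, hs⟩ := Finset.mem_erase.1 hs
      have hsp : s ≤ p := Finset.mem_Iic.1 hs
      have h1 := op_ev_mem_wordSpan (k := k) d ⟨L, c, 0⟩ (m + s) (ev_mem_wordSpan (N := N)
        (P := fun w => w.length = b.length ∧ (d → w.ind = 0)) hb ⟨rfl, hd⟩)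
      refine map_mem_of_wordSpan (op k (p - s) (gen _ a)) (fun u hu h => ?_) h1
      refine ev_mem_wordSpan (w := u.prepend [(a, p - s)]) (isNormal_prepend.2 ⟨?_, hu⟩)
        ⟨Word.lt_prepend_cons (v := Word.append ⟨L, c, 0⟩ m b) ?_ a (Word.toLex_sub_lt hsp hs0), h.2⟩
      · intro x hx
        rw [List.mem_singleton.1 hx]
        exact fun l => lt_of_le_of_lt (Nat.sub_le _ _) (hp l)
      · rw [h.1]
        simp [Word.length, Word.append]
        omega

end Leading

/-! ### Extension of maps without locality of the target. -/

section Universal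

variable {k : Type*} [Field k] {n : ℕ} {B : Type*}

/-- A map from the generators to a space with operations extends to the free associative
`n`-conformal algebra as soon as the identities hold and the images of the generators are local;
locality of arbitrary elements of the target is not needed. -/
theorem exists_lift_of_local {A : Type*} [AddCommGroup A] [Module k A] [ConformalOps k n A]
    (der_comm : ∀ (i j : Fin n) (x : A), der k i (der k j x) = der k j (der k i x))
    (leibniz : ∀ (i : Fin n) (m : Idx n) (x y : A),
      der k i (op k m x y) = op k m (der k i x) y + op k m x (der k i y))
    (der_op : ∀ (i : Fin n) (m : Idx n) (x y : A),
      op k m (der k i x) y = -((m i : k) • op k (m - Pi.single i 1) x y))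
    (assoc : ∀ (m m' : Idx n) (x y z : A), op k m' (op k m x y) z =
      ∑ s ∈ Finset.Iic m, coeff k m s • op k (m - s) x (op k (m' + s) y z))
    (N : B → B → Idx n) (e : B → A)
    (he : ∀ (a b : B) (m : Idx n), ¬ Below m (N a b) → op k m (e a) (e b) = 0) :
    ∃ φ : FreeConf k N →ₗ[k] A, (∀ b, φ (gen N b) = e b) ∧
      (∀ (i : Fin n) x, φ (der k i x) = der k i (φ x)) ∧
      (∀ (m : Idx n) x y, φ (op k m x y) = op k m (φ x) (φ y)) := by
  let ψ : (Term n B →₀ k) →ₗ[k] A := Finsupp.linearCombination k (Term.eval (k := k) e)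
  have hder : ∀ (i : Fin n) x, ψ (der k i x) = der k i (ψ x) := by
    intro i x
    induction x using Finsupp.induction_linear with
    | zero => simp
    | add f g hf hg => simp only [map_add, hf, hg]
    | single t r => simp [ψ, der, ConformalOps.der', Term.eval]
  have hop : ∀ (m : Idx n) x y, ψ (op k m x y) = op k m (ψ x) (ψ y) := by
    intro m x y
    induction x using Finsupp.induction_linear with
    | zero => simp
    | add f g hf hg => simp only [map_add, LinearMap.add_apply, hf, hg]
    | single t r =>
      induction y using Finsupp.induction_linear with
      | zero => simp
      | add f g hf hg => simp only [map_add, hf, hg]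
      | single t' r' =>
        simp [ψ, op, ConformalOps.op', Term.eval, mul_smul, smul_comm r r', -Finsupp.single_mul]
  have hker : idealSpan k n {x | FreeRel k N x} ≤ LinearMap.ker ψ := by
    apply idealSpan_le
    · constructor
      · intro i x hx
        rw [LinearMap.mem_ker] at *
        rw [hder, hx, map_zero]
      · intro m x y hy
        rw [LinearMap.mem_ker] at *
        rw [hop, hy, map_zero]
      · intro m x hx y
        rw [LinearMap.mem_ker] at *
        rw [hop, hx, map_zero, LinearMap.zero_apply]
    · intro x hx
      rw [SetLike.mem_coe, LinearMap.mem_ker]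
      cases hx with
      | der_comm i j x => rw [map_sub, sub_eq_zero, hder, hder, hder, hder, der_comm]
      | locality a b m hm => rw [hop]; simpa [ψ, Term.eval] using he a b m hm
      | leibniz i m x y => simp only [map_sub, map_add, hder, hop, leibniz, sub_self]
      | der_op i m x y => simp only [map_sub, map_neg, map_smul, hder, hop, der_op, sub_self]
      | assoc m m' x y z => simp only [map_sub, map_sum, map_smul, hop, assoc, sub_self]
  refine ⟨Submodule.liftQ _ ψ hker, ?_, ?_, ?_⟩
  · intro b
    simp [gen, ψ, Term.eval]
  · intro i x
    obtain ⟨x, rfl⟩ := Submodule.mkQ_surjective _ x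
    exact hder i x
  · intro m x y
    obtain ⟨x, rfl⟩ := Submodule.mkQ_surjective _ x
    obtain ⟨y, rfl⟩ := Submodule.mkQ_surjective _ y
    exact hop m x y

end Universal

/-! ### Pascal's rule for the sums of the associativity law. -/

section Pascal

variable {k : Type*} [Field k] {M : Type*} [AddCommGroup M] [Module k M]

theorem sum_choose_succ (F : ℕ → ℕ → M) (m : ℕ) :
    ∑ s ∈ Finset.range (m + 1 + 1), ((-1) ^ s * ((m + 1).choose s : k)) • F (m + 1 - s) s =
      ∑ s ∈ Finset.range (m + 1),
        ((-1) ^ s * (m.choose s : k)) • (F (m - s + 1) s - F (m - s) (s + 1)) := by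
  have h1 : ∑ s ∈ Finset.range (m + 1), ((-1) ^ s * (m.choose s : k)) • F (m - s + 1) s =
      ∑ s ∈ Finset.range (m + 1 + 1), ((-1) ^ s * (m.choose s : k)) • F (m + 1 - s) s := by
    rw [Finset.sum_range_succ _ (m + 1)]
    simp only [Nat.choose_succ_self, Nat.cast_zero, mul_zero, zero_smul, add_zero]
    refine Finset.sum_congr rfl fun s hs => ?_
    rw [Finset.mem_range] at hs
    rw [show m - s + 1 = m + 1 - s by omega]
  simp only [smul_sub, Finset.sum_sub_distrib]
  rw [h1, Finset.sum_range_succ', Finset.sum_range_succ' _ (m + 1)]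
  simp only [Nat.choose_succ_succ, Nat.cast_add, mul_add, add_smul, Finset.sum_add_distrib,
    Nat.add_sub_add_right, pow_succ, mul_neg_one, neg_mul, neg_smul, Finset.sum_neg_distrib,
    Nat.choose_zero_right]
  abel

theorem sum_Iic_two (f : Idx 2 → M) (m : Idx 2) :
    ∑ s ∈ Finset.Iic m, f s =
      ∑ a ∈ Finset.range (m 0 + 1), ∑ b ∈ Finset.range (m 1 + 1), f ![a, b] := by
  rw [← Finset.sum_product']
  refine Finset.sum_nbij' (fun s => (s 0, s 1)) (fun p => ![p.1, p.2]) ?_ ?_ ?_ ?_ ?_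
  · intro s hs
    have := Finset.mem_Iic.1 hs
    simp [this 0, this 1]
  · rintro ⟨a, b⟩ h
    simp only [Finset.mem_product, Finset.mem_range, Nat.lt_succ_iff] at h
    rw [Finset.mem_Iic]
    intro i
    fin_cases i
    exacts [h.1, h.2]
  · intro s _
    funext i
    fin_cases i <;> rfl
  · rintro ⟨a, b⟩ _
    rfl
  · intro s _
    congr 1
    funext i
    fin_cases i <;> rfl

theorem sum_coeff_two (F : Idx 2 → Idx 2 → M) (m : Idx 2) :
    ∑ s ∈ Finset.Iic m, coeff k m s • F (m - s) s =
      ∑ a ∈ Finset.range (m 0 + 1), ((-1) ^ a * ((m 0).choose a : k)) •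
        ∑ b ∈ Finset.range (m 1 + 1), ((-1) ^ b * ((m 1).choose b : k)) •
          F ![m 0 - a, m 1 - b] ![a, b] := by
  rw [sum_Iic_two]
  refine Finset.sum_congr rfl fun a _ => ?_
  rw [Finset.smul_sum]
  refine Finset.sum_congr rfl fun b _ => ?_
  have h1 : m - ![a, b] = ![m 0 - a, m 1 - b] := by
    funext i
    fin_cases i <;> rfl
  rw [h1, smul_smul]
  congr 1
  simp [coeff, pow_add]
  ring

/-- Pascal's rule in the coordinate `i`. It shows that the right side of associativity obeys the
recursion in `m` that defines the products of sequences, see `seq_op_add_single`. -/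
theorem sum_coeff_add_single (F : Idx 2 → Idx 2 → M) (m : Idx 2) (i : Fin 2) :
    ∑ s ∈ Finset.Iic (m + Pi.single i 1), coeff k (m + Pi.single i 1) s •
        F (m + Pi.single i 1 - s) s =
      ∑ s ∈ Finset.Iic m, coeff k m s •
        (F (m - s + Pi.single i 1) s - F (m - s) (s + Pi.single i 1)) := by
  refine Eq.trans ?_ (sum_coeff_two
    (fun p s => F (p + Pi.single i 1) s - F p (s + Pi.single i 1)) m).symm
  rw [sum_coeff_two]
  have e0 : ∀ a b : ℕ, ![a, b] + Pi.single 0 1 = ![a + 1, b] := by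
    intro a b; funext j; fin_cases j <;> simp
  have e1 : ∀ a b : ℕ, ![a, b] + Pi.single 1 1 = ![a, b + 1] := by
    intro a b; funext j; fin_cases j <;> simp
  fin_cases i
  · simp only [Fin.zero_eta, Pi.add_apply, Pi.single_eq_same, e0, ne_eq, one_ne_zero,
      not_false_eq_true, Pi.single_eq_of_ne, add_zero]
    rw [sum_choose_succ (fun p a => ∑ b ∈ Finset.range (m 1 + 1),
      ((-1) ^ b * ((m 1).choose b : k)) • F ![p, m 1 - b] ![a, b])]
    simp only [smul_sub, Finset.sum_sub_distrib]
  · simp only [Fin.mk_one, Pi.add_apply, Pi.single_eq_same, e1, ne_eq, zero_ne_one,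
      not_false_eq_true, Pi.single_eq_of_ne, add_zero]
    refine Finset.sum_congr rfl fun a _ => ?_
    rw [sum_choose_succ (fun p b => F ![m 0 - a, p] ![a, b])]

end Pascal

/-! The operations on sequences with values in an associative algebra, i.e. on formal
distributions. They satisfy all the identities of an associative `2`-conformal algebra but
locality. -/

section Distributions

variable (k : Type*) [Field k] {A : Type*} [Ring A] [Algebra k A]

/-- The shift `(Tᵢx)(n) = x(n + eᵢ)`. -/
def seqShift (i : Fin 2) : (Idx 2 → A) →ₗ[k] (Idx 2 → A) :=
  LinearMap.funLeft k A fun n => n + Pi.single i 1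

/-- The product `x ⟨0⟩ y`. -/
def seqMul : (Idx 2 → A) →ₗ[k] (Idx 2 → A) →ₗ[k] (Idx 2 → A) :=
  LinearMap.mk₂ k (fun x y n => x 0 * y n) (fun x x' y => by ext; simp [add_mul])
    (fun c x y => by ext; simp) (fun x y y' => by ext; simp [mul_add]) (fun c x y => by ext; simp)

/-- The passage from `⟨m⟩` to `⟨m + eᵢ⟩`. -/
def seqStep (i : Fin 2) (b : (Idx 2 → A) →ₗ[k] (Idx 2 → A) →ₗ[k] (Idx 2 → A)) :
    (Idx 2 → A) →ₗ[k] (Idx 2 → A) →ₗ[k] (Idx 2 → A) :=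
  b.comp (seqShift k i) - b.compl₂ (seqShift k i)

/-- In closed form `(x⟨m⟩y)(n)` is the sum over `s ≤ m` of `(-1)^s (m choose s) x(m - s) y(n + s)`.
The iterated form makes every identity an induction on `m`. -/
instance seqConformalOps : ConformalOps k 2 (Idx 2 → A) where
  op' m := (seqStep k 0)^[m 0] ((seqStep k 1)^[m 1] (seqMul k))
  der' i :=
    { toFun := fun x n => -((n i : k) • x (n - Pi.single i 1))
      map_add' := fun x y => by ext; simp [add_comm]
      map_smul' := fun c x => by ext; simp [smul_comm c] }

variable {k}

theorem seqShift_apply (i : Fin 2) (x : Idx 2 → A) (n : Idx 2) :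
    seqShift k i x n = x (n + Pi.single i 1) := rfl

theorem seq_der_apply (i : Fin 2) (x : Idx 2 → A) (n : Idx 2) :
    der k i x n = -((n i : k) • x (n - Pi.single i 1)) := rfl

theorem seq_op_zero (x y : Idx 2 → A) (n : Idx 2) : op k (0 : Idx 2) x y n = x 0 * y n := rfl

theorem seqShift_comm (i j : Fin 2) (x : Idx 2 → A) :
    seqShift k i (seqShift k j x) = seqShift k j (seqShift k i x) := by
  funext n
  simp only [seqShift_apply, add_right_comm]

/-- The steps in the two coordinates commute since the shifts do, so a step can be taken in either
direction at any moment. -/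
theorem seq_op_add_single (m : Idx 2) (i : Fin 2) (x y : Idx 2 → A) :
    op k (m + Pi.single i 1) x y = op k m (seqShift k i x) y - op k m x (seqShift k i y) := by
  have hc : Function.Commute (seqStep k 0 (A := A)) (seqStep k 1) := by
    intro b
    ext x y n
    simp only [seqStep, LinearMap.sub_apply, LinearMap.comp_apply, LinearMap.compl₂_apply,
      seqShift_comm 0 1]
    simp only [Pi.sub_apply]
    abel
  have h : (op k (m + Pi.single i 1) : (Idx 2 → A) →ₗ[k] _ →ₗ[k] _) = seqStep k i (op k m) := by
    simp only [op, ConformalOps.op']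
    fin_cases i
    · simp [Function.iterate_succ_apply']
    · simp [Function.iterate_succ_apply', (hc.iterate_left (m 0)).eq]
  rw [h]
  rfl

theorem seqShift_op (i : Fin 2) (m : Idx 2) (x y : Idx 2 → A) :
    seqShift k i (op k m x y) = op k m x (seqShift k i y) := by
  induction m using idx_induction generalizing x y with
  | h0 => rfl
  | hs m j ih => rw [seq_op_add_single, seq_op_add_single, map_sub, ih, ih, seqShift_comm]

/-- The Heisenberg relation of shift and derivation. In `seq_leibniz` its extra terms from the two
factors cancel; in `seq_der_op` each step in direction `i` leaves one behind, and they add up to the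
factor `mᵢ`. -/
theorem seqShift_der (i j : Fin 2) (x : Idx 2 → A) :
    seqShift k i (der k j x) = der k j (seqShift k i x) - if i = j then x else 0 := by
  funext n
  rw [Pi.sub_apply, seqShift_apply, seq_der_apply, seq_der_apply, seqShift_apply]
  split_ifs with h
  · subst h
    rcases Nat.eq_zero_or_pos (n i) with h0 | h0
    · simp [h0]
    · have : n - Pi.single i 1 + Pi.single i 1 = n := tsub_add_cancel_of_le (by
        intro l
        rcases eq_or_ne l i with rfl | hl
        · simpa using Nat.succ_le_of_lt h0
        · simp [hl])
      simp only [this, add_tsub_cancel_right, Pi.add_apply, Pi.single_eq_same, Nat.cast_add,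
        Nat.cast_one, add_smul, one_smul]
      abel
  · have : n + Pi.single i 1 - Pi.single j 1 = n - Pi.single j 1 + Pi.single i 1 := by
      funext l
      simp only [Pi.sub_apply, Pi.add_apply, Pi.single_apply]
      split_ifs <;> omega
    simp [this, Ne.symm h]

theorem seq_der_comm (i j : Fin 2) (x : Idx 2 → A) :
    der k i (der k j x) = der k j (der k i x) := by
  rcases eq_or_ne i j with rfl | h
  · rfl
  funext n
  simp only [seq_der_apply, Pi.sub_apply, Pi.single_eq_of_ne h, Pi.single_eq_of_ne h.symm,
    tsub_zero, smul_neg, neg_neg, smul_smul]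
  rw [mul_comm, tsub_right_comm]

theorem seq_leibniz (i : Fin 2) (m : Idx 2) (x y : Idx 2 → A) :
    der k i (op k m x y) = op k m (der k i x) y + op k m x (der k i y) := by
  induction m using idx_induction generalizing x y with
  | h0 =>
    funext n
    simp [seq_op_zero, seq_der_apply]
  | hs m j ih =>
    simp only [seq_op_add_single, map_sub, ih, seqShift_der, LinearMap.sub_apply]
    split_ifs
    · abel
    · simp only [map_zero, LinearMap.zero_apply]
      abel

theorem seq_der_op (i : Fin 2) (m : Idx 2) (x y : Idx 2 → A) :
    op k m (der k i x) y = -((m i : k) • op k (m - Pi.single i 1) x y) := by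
  induction m using idx_induction generalizing x y with
  | h0 =>
    funext n
    simp [seq_op_zero, seq_der_apply]
  | hs m j ih =>
    simp only [seq_op_add_single, seqShift_der, map_sub, LinearMap.sub_apply, ih]
    split_ifs with h
    · subst h
      rcases Nat.eq_zero_or_pos (m j) with h0 | h0
      · simp [h0]
      · have : m - Pi.single j 1 + Pi.single j 1 = m := tsub_add_cancel_of_le (by
          intro l
          rcases eq_or_ne l j with rfl | hl
          · simpa using Nat.succ_le_of_lt h0
          · simp [hl])
        have h2 := seq_op_add_single (k := k) (m - Pi.single j 1) j x y
        rw [this] at h2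
        simp only [h2, add_tsub_cancel_right, Pi.add_apply, Pi.single_eq_same, Nat.cast_add,
          Nat.cast_one, add_smul, one_smul, smul_sub]
        abel
    · have : m + Pi.single j 1 - Pi.single i 1 = m - Pi.single i 1 + Pi.single j 1 := by
        funext l
        simp only [Pi.sub_apply, Pi.add_apply, Pi.single_apply]
        split_ifs <;> omega
      simp only [this, seq_op_add_single, Pi.add_apply, Pi.single_eq_of_ne (Ne.symm h), add_zero,
        smul_sub, map_zero, LinearMap.zero_apply]
      abel

/-- For `m = 0` both sides obey the same recursion in `m'`, because the shift of `x⟨0⟩y` acts on `y`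
only. The step in `m` is Pascal's rule. -/
theorem seq_assoc (m m' : Idx 2) (x y z : Idx 2 → A) :
    op k m' (op k m x y) z =
      ∑ s ∈ Finset.Iic m, coeff k m s • op k (m - s) x (op k (m' + s) y z) := by
  induction m using idx_induction generalizing x y with
  | h0 =>
    have h : Finset.Iic (0 : Idx 2) = {0} := by
      ext s
      simp [Finset.mem_Iic]
    rw [h, Finset.sum_singleton, coeff_zero, one_smul, tsub_zero, add_zero]
    induction m' using idx_induction generalizing x y z with
    | h0 =>
      funext n
      simp [seq_op_zero, mul_assoc]
    | hs m' j ih => simp only [seq_op_add_single, seqShift_op, ih, map_sub]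
  | hs m j ih =>
    rw [sum_coeff_add_single (fun p s => op k p x (op k (m' + s) y z)), seq_op_add_single, map_sub,
      LinearMap.sub_apply, ih, ih, ← Finset.sum_sub_distrib]
    refine Finset.sum_congr rfl fun s _ => ?_
    rw [← smul_sub, seq_op_add_single, seqShift_op, ← add_assoc, seq_op_add_single, map_sub]
    congr 1
    abel

end Distributions

/-! ### Representations by the sequences `X dⁿ`. -/

section Representation

variable {k : Type*} [Field k] {V : Type*} [AddCommGroup V] [Module k V]

/-- The sequence `n ↦ X dⁿ`. -/
def seqOf (d : Fin 2 → Module.End k V) (X : Module.End k V) : Idx 2 → Module.End k V :=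
  fun n => X * (d 0 ^ n 0 * d 1 ^ n 1)

/-- The vector `X d^{m₁} X d^{m₂} ⋯ X d^{m_r} X v`. -/
def wordVal (X : Module.End k V) (d : Fin 2 → Module.End k V) (v : V) (l : List (Idx 2)) : V :=
  l.foldr (fun m u => X ((d 0 ^ m 0 * d 1 ^ m 1) u)) (X v)

/-- As a polynomial in the index, `n ↦ y(n)v` has the only top coefficient `u`, at `i`. -/
def HasTop (v : V) (i : Idx 2) (y : Idx 2 → Module.End k V) (u : V) : Prop :=
  (∀ n, ¬ n ≤ i → y n v = 0) ∧ y i v = u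

variable {d : Fin 2 → Module.End k V} {X Y : Module.End k V} {v : V}

theorem seqOf_sub : seqOf d (X - Y) = seqOf d X - seqOf d Y := by
  funext n
  simp [seqOf, sub_mul]

theorem mul_pow_mul_pow (hd : Commute (d 0) (d 1)) (i : Fin 2) (n : Idx 2) :
    d i * (d 0 ^ n 0 * d 1 ^ n 1) =
      d 0 ^ (n + Pi.single i 1 : Idx 2) 0 * d 1 ^ (n + Pi.single i 1 : Idx 2) 1 := by
  fin_cases i
  · simp [pow_succ', mul_assoc]
  · simp [pow_succ', ← mul_assoc, (hd.pow_left (n 0)).eq]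

theorem seqShift_seqOf (hd : Commute (d 0) (d 1)) (i : Fin 2) :
    seqShift k i (seqOf d X) = seqOf d (X * d i) := by
  funext n
  rw [seqShift_apply, seqOf, seqOf, mul_assoc, mul_pow_mul_pow hd]

/-- The product depends on the two operators only through their composition, so `dᵢ` may be passed
from one to the other. -/
theorem op_seqOf_mul (hd : Commute (d 0) (d 1)) (m : Idx 2) (i : Fin 2) :
    op k m (seqOf d (X * d i)) (seqOf d Y) = op k m (seqOf d X) (seqOf d (d i * Y)) := by
  induction m using idx_induction generalizing X Y with
  | h0 =>
    funext n
    simp [seq_op_zero, seqOf, mul_assoc]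
  | hs m j ih =>
    have h : d i * d j = d j * d i := by
      fin_cases i <;> fin_cases j <;> first | rfl | exact hd | exact hd.symm
    simp only [seq_op_add_single, seqShift_seqOf hd, mul_assoc, h]
    rw [← mul_assoc, ih, ih]

/-- Raising the index of the product amounts to taking the commutator of `dᵢ` with the right
operator. Two raises give the double commutator, so locality of order two follows from `[dᵢ,[dᵢ,X]]
= 0`. -/
theorem op_add_single_seqOf (hd : Commute (d 0) (d 1)) (m : Idx 2) (i : Fin 2) :
    op k (m + Pi.single i 1) (seqOf d X) (seqOf d Y) =
      op k m (seqOf d X) (seqOf d (d i * Y - Y * d i)) := by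
  rw [seq_op_add_single, seqShift_seqOf hd, seqShift_seqOf hd, op_seqOf_mul hd, seqOf_sub, map_sub]

theorem op_seqOf_eq_zero (hd : Commute (d 0) (d 1))
    (hX : ∀ i, d i * (d i * X - X * d i) - (d i * X - X * d i) * d i = 0) {m : Idx 2}
    (hm : ¬ Below m ![2, 2]) : op k m (seqOf d X) (seqOf d X) = 0 := by
  obtain ⟨i, hi⟩ : ∃ i, 2 ≤ m i := by
    simp only [Below, not_forall, not_lt] at hm
    obtain ⟨i, hi⟩ := hm
    refine ⟨i, ?_⟩
    fin_cases i <;> exact hi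
  have : m = m - Pi.single i 2 + Pi.single i 1 + Pi.single i 1 := by
    funext l
    rcases eq_or_ne l i with rfl | hl
    · simp only [Pi.add_apply, Pi.sub_apply, Pi.single_eq_same]
      omega
    · simp [hl]
  rw [this, op_add_single_seqOf hd, op_add_single_seqOf hd, hX]
  have h0 : seqOf d (0 : Module.End k V) = 0 := by funext n; simp [seqOf]
  rw [h0, map_zero]

/-- A representation of the free associative `2`-conformal algebra on one generator. -/
theorem exists_representation (hd : Commute (d 0) (d 1))
    (hX : ∀ i, d i * (d i * X - X * d i) - (d i * X - X * d i) * d i = 0) :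
    ∃ φ : Conf k Unit ![2, 2] →ₗ[k] (Idx 2 → Module.End k V), φ (gen _ ()) = seqOf d X ∧
      (∀ (i : Fin 2) x, φ (der k i x) = der k i (φ x)) ∧
      (∀ (m : Idx 2) x y, φ (op k m x y) = op k m (φ x) (φ y)) := by
  obtain ⟨φ, h1, h2, h3⟩ := exists_lift_of_local (k := k) (A := Idx 2 → Module.End k V)
    seq_der_comm seq_leibniz seq_der_op seq_assoc (fun _ _ : Unit => ![2, 2])
    (fun _ => seqOf d X) (fun _ _ m hm => op_seqOf_eq_zero hd hX hm)
  exact ⟨φ, h1 (), h2, h3⟩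

theorem hasTop_seqOf (hv : ∀ i, d i v = 0) : HasTop v 0 (seqOf d X) (X v) := by
  refine ⟨fun n hn => ?_, by simp [seqOf]⟩
  have h : ∀ (i : Fin 2) (a : ℕ), a ≠ 0 → (d i ^ a) v = 0 := by
    intro i a ha
    obtain ⟨a, rfl⟩ := Nat.exists_eq_succ_of_ne_zero ha
    rw [pow_succ, Module.End.mul_apply, hv, map_zero]
  rcases Nat.eq_zero_or_pos (n 1) with h1 | h1
  · rcases Nat.eq_zero_or_pos (n 0) with h0 | h0
    · refine absurd (fun i => ?_) hn
      fin_cases i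
      exacts [h0.le, h1.le]
    · simp [seqOf, h1, h 0 _ h0.ne']
  · simp [seqOf, h 1 _ h1.ne']

theorem HasTop.sub {i : Idx 2} {y y' : Idx 2 → Module.End k V} {u u' : V} (h : HasTop v i y u)
    (h' : HasTop v i y' u') : HasTop v i (y - y') (u - u') := by
  refine ⟨fun n hn => ?_, ?_⟩
  · simp [h.1 n hn, h'.1 n hn]
  · simp [h.2, h'.2]

theorem HasTop.shift {i : Idx 2} {y : Idx 2 → Module.End k V} {u : V} (h : HasTop v i y u)
    (j : Fin 2) : HasTop v i (seqShift k j y) 0 := by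
  refine ⟨fun n hn => ?_, ?_⟩
  · exact h.1 _ fun h' => hn (le_trans (fun l => Nat.le_add_right _ _) h')
  · refine h.1 _ fun h' => ?_
    have := h' j
    simp at this

/-- The support moves up by one. The scalar `-(iⱼ + 1)` is nonzero in characteristic `0`, which is
what `hasTop_ev` needs. -/
theorem HasTop.der {i : Idx 2} {y : Idx 2 → Module.End k V} {u : V} (h : HasTop v i y u)
    (j : Fin 2) :
    HasTop v (i + Pi.single j 1) (der k j y) ((-((i j + 1 : ℕ) : k)) • u) := by
  refine ⟨fun n hn => ?_, ?_⟩
  · rw [seq_der_apply]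
    rcases Nat.eq_zero_or_pos (n j) with h0 | h0
    · simp [h0]
    · rw [LinearMap.neg_apply, LinearMap.smul_apply, h.1, smul_zero, neg_zero]
      exact fun h' => hn (tsub_le_iff_right.1 h')
  · rw [seq_der_apply, add_tsub_cancel_right]
    simp only [LinearMap.neg_apply, LinearMap.smul_apply, h.2, Pi.add_apply, Pi.single_eq_same,
      neg_smul]

/-- In the recursion for `m + eⱼ`, the term with shifted `y` has zero value at the top, so only the
replacement of `X` by `X dⱼ` contributes. -/
theorem HasTop.op_seqOf (hd : Commute (d 0) (d 1)) {i : Idx 2} {y : Idx 2 → Module.End k V}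
    {u : V} (h : HasTop v i y u) (m : Idx 2) :
    HasTop v i (op k m (seqOf d X) y) (X ((d 0 ^ m 0 * d 1 ^ m 1) u)) := by
  induction m using idx_induction generalizing X y u with
  | h0 =>
    refine ⟨fun n hn => ?_, ?_⟩
    · simp [seq_op_zero, h.1 n hn]
    · simp [seq_op_zero, h.2, seqOf]
  | hs m j ih =>
    rw [seq_op_add_single, seqShift_seqOf hd, ← mul_pow_mul_pow hd]
    have := (ih (X := X * d j) h).sub (ih (X := X) (h.shift j))
    simpa using this

section

variable {φ : Conf k Unit ![2, 2] →ₗ[k] (Idx 2 → Module.End k V)}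

theorem hasTop_ev [CharZero k] (hd : Commute (d 0) (d 1)) (hv : ∀ i, d i v = 0)
    (h1 : φ (gen _ ()) = seqOf d X) (h2 : ∀ (i : Fin 2) x, φ (der k i x) = der k i (φ x))
    (h3 : ∀ (m : Idx 2) x y, φ (op k m x y) = op k m (φ x) (φ y)) (w : Word 2 Unit) :
    ∃ c : k, c ≠ 0 ∧
      HasTop v w.ind (φ (ev w)) (c • wordVal X d v (w.init.map Prod.snd)) := by
  obtain ⟨L, ⟨⟩, i⟩ := w
  induction L with
  | nil =>
    have : (ev ⟨[], (), i⟩ : Conf k Unit ![2, 2]) = derPow k i (gen _ ()) := rfl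
    rw [this]
    clear this
    induction i using idx_induction with
    | h0 =>
      refine ⟨1, one_ne_zero, ?_⟩
      rw [derPow_zero, h1, one_smul]
      exact hasTop_seqOf hv
    | hs i j ih =>
      obtain ⟨c, hc, h⟩ := ih
      refine ⟨-((i j + 1 : ℕ) : k) * c, mul_ne_zero (neg_ne_zero.2
        (Nat.cast_ne_zero.2 (Nat.succ_ne_zero _))) hc, ?_⟩
      rw [derPow_add_single, h2, mul_smul]
      exact h.der j
  | cons p L ih =>
    obtain ⟨⟨⟩, m⟩ := p
    obtain ⟨c, hc, h⟩ := ih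
    refine ⟨c, hc, ?_⟩
    have : (ev ⟨((), m) :: L, (), i⟩ : Conf k Unit ![2, 2]) = op k m (gen _ ()) (ev ⟨L, (), i⟩) :=
      rfl
    rw [this, h3, h1]
    have h' := h.op_seqOf hd m (X := X)
    rw [map_smul, map_smul] at h'
    exact h'

/-- Take an index `n` maximal among the words occurring in a relation and evaluate the relation at
`n` on `v`. Only words with index exactly `n` survive, and they give a relation between the vectors
`wordVal`. -/
theorem linearIndependent_of_wordVal [CharZero k] (hd : Commute (d 0) (d 1))
    (hv : ∀ i, d i v = 0) (h1 : φ (gen _ ()) = seqOf d X)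
    (h2 : ∀ (i : Fin 2) x, φ (der k i x) = der k i (φ x))
    (h3 : ∀ (m : Idx 2) x y, φ (op k m x y) = op k m (φ x) (φ y)) {J : Set (List (Idx 2))}
    (hJ : LinearIndependent k fun l : J => wordVal X d v l.1) :
    LinearIndependent k
      fun w : {w : Word 2 Unit // w.init.map Prod.snd ∈ J} => φ (ev w.1) := by
  classical
  choose c hc ht using fun w => hasTop_ev hd hv h1 h2 h3 w
  rw [linearIndependent_iff']
  intro s g hg
  by_contra! hne
  let t := s.filter fun w => g w ≠ 0
  have htne : (t.image fun w => w.1.ind).Nonempty := by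
    obtain ⟨w, hw, hw'⟩ := hne
    exact ⟨w.1.ind, Finset.mem_image_of_mem _ (Finset.mem_filter.2 ⟨hw, hw'⟩)⟩
  obtain ⟨n, hn, hmax⟩ := (t.image fun w => w.1.ind).exists_maximal htne
  obtain ⟨w₀, hw₀, rfl⟩ := Finset.mem_image.1 hn
  set n := w₀.1.ind with hn_def
  have hval : ∑ w ∈ t.filter (fun w => w.1.ind = n), (g w * c w.1) •
      wordVal X d v (w.1.init.map Prod.snd) = 0 := by
    have h0 := congrArg (fun y : Idx 2 → Module.End k V => y n v) hg
    simp only [Finset.sum_apply, LinearMap.sum_apply, Pi.smul_apply, LinearMap.smul_apply,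
      Pi.zero_apply, LinearMap.zero_apply] at h0
    rw [← h0]
    have hsub : t.filter (fun w => w.1.ind = n) ⊆ s :=
      (Finset.filter_subset _ _).trans (Finset.filter_subset _ _)
    rw [← Finset.sum_subset hsub]
    · refine Finset.sum_congr rfl fun w hw => ?_
      obtain ⟨-, hw⟩ := Finset.mem_filter.1 hw
      rw [mul_smul, ← (ht w.1).2, hw]
    · intro w hws hw
      by_cases hgw : g w = 0
      · rw [hgw, zero_smul]
      have hwt : w ∈ t := Finset.mem_filter.2 ⟨hws, hgw⟩
      rw [(ht w.1).1, smul_zero]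
      intro hle
      refine hw (Finset.mem_filter.2 ⟨hwt, le_antisymm ?_ hle⟩)
      exact hmax (Finset.mem_image_of_mem _ hwt) hle
  -- There is only one letter, so a word of index `n` is determined by its sequence of
  -- multi-indices.
  have hinj : Function.Injective
      fun w : {w : {w : Word 2 Unit // w.init.map Prod.snd ∈ J} // w.1.ind = n} =>
        (⟨w.1.1.init.map Prod.snd, w.1.2⟩ : J) := by
    rintro ⟨⟨⟨l, ⟨⟩, i⟩, h⟩, hi⟩ ⟨⟨⟨l', ⟨⟩, i'⟩, h'⟩, hi'⟩ heq
    have h4 : l.map Prod.snd = l'.map Prod.snd := congrArg Subtype.val heq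
    have h5 : l = l' := (List.map_injective_iff.2 (fun p q h => by
      obtain ⟨⟨⟩, p⟩ := p
      obtain ⟨⟨⟩, q⟩ := q
      exact congrArg _ h)) h4
    subst h5
    have h6 : i = i' := hi.trans hi'.symm
    subst h6
    rfl
  have hli := linearIndependent_iff'.1 (hJ.comp _ hinj)
    ((t.filter fun w => w.1.ind = n).subtype fun w => w.1.ind = n)
    (fun w => g w.1 * c w.1.1) (by
      rw [← hval]
      have h7 := Finset.sum_subtype_of_mem (s := t.filter fun w => w.1.ind = n)
        (p := fun w => w.1.ind = n)
        (fun w => (g w * c w.1) • wordVal X d v (w.1.init.map Prod.snd))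
        (fun w hw => (Finset.mem_filter.1 hw).2)
      exact h7) ⟨w₀, rfl⟩ (Finset.mem_subtype.2 (Finset.mem_filter.2 ⟨hw₀, rfl⟩))
  exact (mul_ne_zero (Finset.mem_filter.1 hw₀).2 (hc _)) hli

end

end Representation

/-! The representation on functions of words, in which the derivations act letterwise. -/

section Faithful

variable (k : Type*) [Field k]

/-- Multiplication by the letter `p` on functions of words. -/
def letterMul (p : Idx 2) : Module.End k (List (Idx 2) → k) where
  toFun x
    | [] => 0
    | q :: l => if q = p then x l else 0
  map_add' x y := by
    funext l
    cases l with
    | nil => simp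
    | cons q l => by_cases h : q = p <;> simp [h]
  map_smul' c x := by
    funext l
    cases l with
    | nil => simp
    | cons q l => by_cases h : q = p <;> simp [h]

/-- The coefficients of `∂ᵢx`, where the derivation `∂ᵢ` takes a letter `p` with `pᵢ = 0` to `p + eᵢ`
and the other ones to `0`. -/
def letterDerFun (i : Fin 2) : List (Idx 2) → (List (Idx 2) → k) → k
  | [], _ => 0
  | q :: l, x => (if q i = 1 then x ((q - Pi.single i 1) :: l) else 0) +
      letterDerFun i l fun l' => x (q :: l')

/-- The derivation `∂ᵢ` on functions of words. -/
def letterDer (i : Fin 2) : Module.End k (List (Idx 2) → k) where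
  toFun x l := letterDerFun k i l x
  map_add' x y := by
    funext l
    induction l generalizing x y with
    | nil => simp [letterDerFun]
    | cons q l ih =>
      have h : letterDerFun k i l (fun l' => (x + y) (q :: l')) =
        letterDerFun k i l (fun l' => x (q :: l')) + letterDerFun k i l (fun l' => y (q :: l')) :=
        ih _ _
      rw [Pi.add_apply, letterDerFun, h, letterDerFun, letterDerFun, Pi.add_apply]
      split_ifs <;> ring
  map_smul' c x := by
    funext l
    induction l generalizing x with
    | nil => simp [letterDerFun]
    | cons q l ih =>
      have h : letterDerFun k i l (fun l' => (c • x) (q :: l')) =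
        c * letterDerFun k i l (fun l' => x (q :: l')) := ih _
      rw [RingHom.id_apply, Pi.smul_apply, letterDerFun, h, letterDerFun, Pi.smul_apply,
        smul_eq_mul, smul_eq_mul]
      split_ifs <;> ring

variable {k}

theorem letterMul_nil (p : Idx 2) (x : List (Idx 2) → k) : letterMul k p x [] = 0 := rfl

theorem letterMul_cons (p : Idx 2) (x : List (Idx 2) → k) (q : Idx 2) (l : List (Idx 2)) :
    letterMul k p x (q :: l) = if q = p then x l else 0 := rfl

theorem letterDer_nil (i : Fin 2) (x : List (Idx 2) → k) : letterDer k i x [] = 0 := rfl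

theorem letterDer_cons (i : Fin 2) (x : List (Idx 2) → k) (q : Idx 2) (l : List (Idx 2)) :
    letterDer k i x (q :: l) = (if q i = 1 then x ((q - Pi.single i 1) :: l) else 0) +
      letterDer k i (fun l' => x (q :: l')) l := rfl

theorem letterDer_comm : Commute (letterDer k 0) (letterDer k 1) := by
  refine LinearMap.ext fun x => funext fun l => ?_
  simp only [Module.End.mul_apply]
  induction l generalizing x with
  | nil => rfl
  | cons q l ih =>
    have h : ∀ (i : Fin 2) (x : List (Idx 2) → k), (fun l' => letterDer k i x (q :: l')) =
        (if q i = 1 then fun l' => x ((q - Pi.single i 1) :: l') else 0) +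
          letterDer k i (fun l' => x (q :: l')) := by
      intro i x
      funext l'
      rw [letterDer_cons]
      split_ifs <;> rfl
    rw [letterDer_cons 0, letterDer_cons 1 (letterDer k 0 x), h, h, map_add, map_add]
    simp only [Pi.add_apply, ih, letterDer_cons]
    have h0 : (q - Pi.single 0 1 : Idx 2) 1 = q 1 := by simp
    have h1 : (q - Pi.single 1 1 : Idx 2) 0 = q 0 := by simp
    rw [h0, h1, tsub_right_comm]
    split_ifs <;> (try simp only [Pi.zero_apply, map_zero]) <;> (try ring)

/-- The commutator of a derivation with multiplication by `p` is multiplication by `∂ᵢp`. Applied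
twice to the letter `0` it gives `0`, since `eᵢ` has a nonzero coordinate `i`: this is the locality
condition. -/
theorem letterDer_letterMul (i : Fin 2) (p : Idx 2) :
    letterDer k i * letterMul k p - letterMul k p * letterDer k i =
      if p i = 0 then letterMul k (p + Pi.single i 1) else 0 := by
  refine LinearMap.ext fun x => funext fun l => ?_
  have hz : ∀ l, letterDer k i (fun _ => (0 : k)) l = 0 := fun l => by
    have : (fun _ => (0 : k)) = (0 : List (Idx 2) → k) := rfl
    rw [this, map_zero]; rfl
  cases l with
  | nil =>
    simp only [LinearMap.sub_apply, Module.End.mul_apply, Pi.sub_apply, letterDer_nil,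
      letterMul_nil]
    split_ifs <;> simp [letterMul_nil]
  | cons q l =>
    simp only [LinearMap.sub_apply, Module.End.mul_apply, Pi.sub_apply, letterDer_cons,
      letterMul_cons]
    have h1 : letterDer k i (fun l' => if q = p then x l' else 0) l =
        if q = p then letterDer k i x l else 0 := by
      split_ifs
      · rfl
      · exact hz l
    rw [h1, add_sub_cancel_right]
    have h2 : (q i = 1 ∧ q - Pi.single i 1 = p) ↔ (p i = 0 ∧ q = p + Pi.single i 1) := by
      constructor
      · rintro ⟨h, rfl⟩
        refine ⟨by simp [h], (tsub_add_cancel_of_le fun l => ?_).symm⟩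
        rcases eq_or_ne l i with rfl | hl
        · simp [h]
        · simp [hl]
      · rintro ⟨h, rfl⟩
        exact ⟨by simp [h], add_tsub_cancel_right _ _⟩
    rw [← ite_and]
    simp only [h2]
    split_ifs with h3 h4 h5 <;> simp_all [letterMul_cons]

theorem letterDer_letterMul_apply (i : Fin 2) (p : Idx 2) (x : List (Idx 2) → k) :
    letterDer k i (letterMul k p x) = (if p i = 0 then letterMul k (p + Pi.single i 1) x else 0) +
      letterMul k p (letterDer k i x) := by
  have := LinearMap.congr_fun (letterDer_letterMul (k := k) i p) x
  rw [LinearMap.sub_apply, Module.End.mul_apply, Module.End.mul_apply, sub_eq_iff_eq_add] at this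
  rw [this]
  split_ifs <;> rfl

/-- The indicator of the empty word. -/
def emptyVec (k : Type*) [Field k] : List (Idx 2) → k
  | [] => 1
  | _ :: _ => 0

theorem letterDer_emptyVec (i : Fin 2) : letterDer k i (emptyVec k) = 0 := by
  funext l
  cases l with
  | nil => rfl
  | cons q l =>
    rw [letterDer_cons]
    have : (fun l' => emptyVec k (q :: l')) = 0 := rfl
    rw [this, map_zero]
    simp [emptyVec]

/-- Among the Leibniz terms, the one where all derivations hit the first letter turns it into `m`.
In the others the first letter stays strictly smaller, and they form `r`. -/
theorem exists_letterMul_add {m : Idx 2} (hm : Below m ![2, 2]) (u : List (Idx 2) → k) :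
    ∃ r : List (Idx 2) → k, (letterDer k 0 ^ m 0 * letterDer k 1 ^ m 1) (letterMul k 0 u) =
      letterMul k m u + r ∧ ∀ q l, ¬ toLex q < toLex m → r (q :: l) = 0 := by
  have h0 : m 0 < 2 := hm 0
  have h1 : m 1 < 2 := hm 1
  have hm' : m = ![m 0, m 1] := by funext i; fin_cases i <;> rfl
  have hlt : ∀ p, p < m → toLex p < toLex m := fun p h => Pi.toLex_strictMono h
  have key : ∀ (p : Idx 2), p < m → ∀ x q l, ¬ toLex q < toLex m → letterMul k p x (q :: l) = 0 := by
    intro p hp x q l hq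
    rw [letterMul_cons, if_neg]
    rintro rfl
    exact hq (hlt _ hp)
  have e0 : (0 : Idx 2) + Pi.single 0 1 = ![1, 0] := by decide
  have e1 : (0 : Idx 2) + Pi.single 1 1 = ![0, 1] := by decide
  have e2 : (![0, 1] : Idx 2) + Pi.single 0 1 = ![1, 1] := by decide
  generalize m 0 = a at *
  generalize m 1 = b at *
  subst hm'
  interval_cases a <;> interval_cases b
  · refine ⟨0, ?_, fun _ _ _ => rfl⟩
    have : (![0, 0] : Idx 2) = 0 := by decide
    simp [this]
  · refine ⟨letterMul k 0 (letterDer k 1 u), ?_, fun q l hq => key 0 (by simp [Pi.lt_def]) _ q l hq⟩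
    simp [letterDer_letterMul_apply, e1]
  · refine ⟨letterMul k 0 (letterDer k 0 u), ?_, fun q l hq => key 0 (by simp [Pi.lt_def]) _ q l hq⟩
    simp [letterDer_letterMul_apply, e0]
  · refine ⟨letterMul k ![0, 1] (letterDer k 0 u) + (letterMul k ![1, 0] (letterDer k 1 u) +
      letterMul k 0 (letterDer k 0 (letterDer k 1 u))), ?_, fun q l hq => ?_⟩
    · simp [letterDer_letterMul_apply, e0, e1, e2, add_assoc]
    · simp only [Pi.add_apply]
      rw [key _ (by simp [Pi.lt_def, Pi.le_def, Fin.forall_fin_two]) _ q l hq,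
        key _ (by simp [Pi.lt_def, Pi.le_def, Fin.forall_fin_two]) _ q l hq,
        key _ (by simp [Pi.lt_def]) _ q l hq]
      simp

/-- Triangularity: the value of `l` is the word `0 :: l` plus words `0 :: l'` with `l'`
lexicographically smaller than `l`. -/
theorem exists_wordVal_eq : ∀ (l : List (Idx 2)), (∀ m ∈ l, Below m ![2, 2]) →
    ∃ u : List (Idx 2) → k,
      wordVal (letterMul k 0) (letterDer k) (emptyVec k) l = letterMul k 0 u ∧ u l = 1 ∧
        ∀ l', ¬ List.Lex (fun p q : Idx 2 => toLex p < toLex q) l' l → l' ≠ l → u l' = 0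
  | [], _ => ⟨emptyVec k, rfl, rfl, fun l' _ h => by
      cases l' with
      | nil => exact absurd rfl h
      | cons q l' => rfl⟩
  | m :: l, hl => by
    obtain ⟨u, hu, hu1, hu2⟩ := exists_wordVal_eq l fun m hm => hl m (List.mem_cons_of_mem _ hm)
    obtain ⟨r, hr, hr'⟩ := exists_letterMul_add (k := k) (hl m List.mem_cons_self) u
    refine ⟨letterMul k m u + r, ?_, ?_, ?_⟩
    · rw [← hr, ← hu]
      rfl
    · simp [letterMul_cons, hu1, hr' m l (_root_.lt_irrefl _)]
    · rintro (_ | ⟨q, l'⟩) hlex hne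
      · exact absurd List.Lex.nil hlex
      rw [Pi.add_apply, hr' q l' fun h => hlex (List.Lex.rel h), letterMul_cons, add_zero]
      split_ifs with h
      · subst h
        exact hu2 l' (fun h => hlex (List.Lex.cons h)) (fun h => hne (by rw [h]))
      · rfl

theorem linearIndependent_wordVal_letterMul :
    LinearIndependent k fun l : {l : List (Idx 2) | ∀ m ∈ l, Below m ![2, 2]} =>
      wordVal (letterMul k 0) (letterDer k) (emptyVec k) l.1 := by
  classical
  choose u hu hu1 hu2 using fun l : {l : List (Idx 2) | ∀ m ∈ l, Below m ![2, 2]} =>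
    exists_wordVal_eq (k := k) l.1 l.2
  simp only [hu]
  rw [linearIndependent_iff']
  intro s g hg
  by_contra! hne
  obtain ⟨l₀, hl₀, hgl₀⟩ := hne
  let f : {l : List (Idx 2) | ∀ m ∈ l, Below m ![2, 2]} → List (Lex (Idx 2)) := fun l => l.1
  obtain ⟨l, hl, hmax⟩ := (s.filter fun l => g l ≠ 0).exists_max_image f
    ⟨l₀, Finset.mem_filter.2 ⟨hl₀, hgl₀⟩⟩
  obtain ⟨hls, hgl⟩ := Finset.mem_filter.1 hl
  -- For `l` greatest among the lists with nonzero coefficient, no other term of the relation sees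
  -- the word `0 :: l`.
  have h := congrFun hg (0 :: l.1)
  rw [Finset.sum_apply, Finset.sum_eq_single_of_mem l hls] at h
  · simp [letterMul_cons, hu1] at h
    exact hgl h
  · intro l' hl' hne
    by_cases h0 : g l' = 0
    · simp [h0]
    · have hle := hmax l' (Finset.mem_filter.2 ⟨hl', h0⟩)
      rw [Pi.smul_apply, letterMul_cons, if_pos rfl, hu2 l' l.1 (fun hlt => ?_)
        (fun h => hne (Subtype.ext h.symm)), smul_zero]
      exact absurd hlt (not_lt_of_ge hle)

/-- The normal words of the free associative `2`-conformal algebra with locality `(2, 2)` are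
linearly independent. -/
theorem linearIndependent_ev [CharZero k] :
    LinearIndependent k fun w : {w : Word 2 Unit // w.IsNormal ![2, 2]} =>
      (ev w.1 : Conf k Unit ![2, 2]) := by
  have hloc : ∀ i, letterDer k i * (letterDer k i * letterMul k 0 - letterMul k 0 * letterDer k i) -
      (letterDer k i * letterMul k 0 - letterMul k 0 * letterDer k i) * letterDer k i = 0 := by
    intro i
    have h := letterDer_letterMul (k := k) i 0
    rw [Pi.zero_apply, if_pos rfl] at h
    rw [h, letterDer_letterMul, if_neg (by simp)]
  obtain ⟨φ, h1, h2, h3⟩ := exists_representation letterDer_comm hloc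
  have h := linearIndependent_of_wordVal letterDer_comm letterDer_emptyVec h1 h2 h3
    linearIndependent_wordVal_letterMul
  have h' : LinearIndependent k fun w : {w : Word 2 Unit //
      w.init.map Prod.snd ∈ {l : List (Idx 2) | ∀ m ∈ l, Below m ![2, 2]}} =>
        (ev w.1 : Conf k Unit ![2, 2]) := LinearIndependent.of_comp φ h
  have hmem : ∀ w : Word 2 Unit, w.IsNormal ![2, 2] →
      w.init.map Prod.snd ∈ {l : List (Idx 2) | ∀ m ∈ l, Below m ![2, 2]} := by
    intro w hw m hm
    obtain ⟨p, hp, rfl⟩ := List.mem_map.1 hm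
    exact hw p hp
  have hinj : Function.Injective fun w : {w : Word 2 Unit // w.IsNormal ![2, 2]} =>
      (⟨w.1, hmem w.1 w.2⟩ : {w : Word 2 Unit //
        w.init.map Prod.snd ∈ {l : List (Idx 2) | ∀ m ∈ l, Below m ![2, 2]}}) := by
    intro w w' h
    rw [Subtype.mk.injEq] at h
    exact Subtype.ext h
  have h'' := h'.comp _ hinj
  exact h''

end Faithful

/-! The representation in which the generator is idempotent.  The space `Fin 8 → k[X]` stands for the
algebra over `k[X]` with the basis `1, b₁, b₂, b₂b₁, e, b₁e, b₂e, b₂b₁e`, where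
`b₁² = b₂² = e² = 0`, `b₁b₂ + b₂b₁ = X`, and `e` anticommutes with `b₁` and `b₂`.  Its derivations
`∂₁`, `∂₂` satisfy `∂ᵢbᵢ = ∂ᵢe = 0` and `∂₁b₂ = ∂₂b₁ = e`. -/

section Idempotent

open Polynomial

variable (k : Type*) [Field k]

/-- Left multiplication by `b₁` and `b₂`. -/
noncomputable def clMul : Fin 2 → Module.End k (Fin 8 → k[X])
  | 0 =>
    { toFun := fun p => ![X * p 2, p 0 + X * p 3, 0, -p 2, X * p 6, p 4 + X * p 7, 0, -p 6]
      map_add' := fun p q => by ext i : 1; fin_cases i <;> simp <;> ring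
      map_smul' := fun c p => by ext i : 1; fin_cases i <;> simp }
  | 1 =>
    { toFun := fun p => ![0, 0, p 0, p 1, 0, 0, p 4, p 5]
      map_add' := fun p q => by ext i : 1; fin_cases i <;> simp
      map_smul' := fun c p => by ext i : 1; fin_cases i <;> simp }

/-- The derivations `∂₁` and `∂₂`. -/
noncomputable def clDer : Fin 2 → Module.End k (Fin 8 → k[X])
  | 0 =>
    { toFun := fun p => ![0, 0, 0, 0, p 2, -p 3, 0, 0]
      map_add' := fun p q => by ext i : 1; fin_cases i <;> simp <;> ring
      map_smul' := fun c p => by ext i : 1; fin_cases i <;> simp }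
  | 1 =>
    { toFun := fun p => ![0, 0, 0, 0, p 1, 0, p 3, 0]
      map_add' := fun p q => by ext i : 1; fin_cases i <;> simp
      map_smul' := fun c p => by ext i : 1; fin_cases i <;> simp }

variable {k}

theorem clMul_zero_apply (p : Fin 8 → k[X]) : clMul k 0 p =
    ![X * p 2, p 0 + X * p 3, 0, -p 2, X * p 6, p 4 + X * p 7, 0, -p 6] := rfl

theorem clMul_one_apply (p : Fin 8 → k[X]) :
    clMul k 1 p = ![0, 0, p 0, p 1, 0, 0, p 4, p 5] := rfl

theorem clDer_zero_apply (p : Fin 8 → k[X]) :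
    clDer k 0 p = ![0, 0, 0, 0, p 2, -p 3, 0, 0] := rfl

theorem clDer_one_apply (p : Fin 8 → k[X]) :
    clDer k 1 p = ![0, 0, 0, 0, p 1, 0, p 3, 0] := rfl

theorem clMul_clMul (i : Fin 2) (p : Fin 8 → k[X]) : clMul k i (clMul k i p) = 0 := by
  fin_cases i
  · simp only [Fin.zero_eta, clMul_zero_apply]
    ext j : 1; fin_cases j <;> simp
  · simp only [Fin.mk_one, clMul_one_apply]
    ext j : 1; fin_cases j <;> simp

theorem clDer_clMul (i : Fin 2) (p : Fin 8 → k[X]) :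
    clDer k i (clMul k i p) = clMul k i (clDer k i p) := by
  fin_cases i
  · simp only [Fin.zero_eta, clMul_zero_apply, clDer_zero_apply]
    ext j : 1; fin_cases j <;> simp
  · simp only [Fin.mk_one, clMul_one_apply, clDer_one_apply]
    ext j : 1; fin_cases j <;> simp

theorem clDer_comm (p : Fin 8 → k[X]) : clDer k 0 (clDer k 1 p) = clDer k 1 (clDer k 0 p) := by
  simp only [clDer_zero_apply, clDer_one_apply]
  ext j : 1; fin_cases j <;> simp

/-- Both sides are `ep + b₂∂₁p + b₁∂₂p`, because `∂₁b₂ = ∂₂b₁ = e`. This makes the derivations of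
the pairs commute. -/
theorem clDer_clMul_symm (p : Fin 8 → k[X]) :
    clDer k 0 (clMul k 1 p) + clMul k 0 (clDer k 1 p) =
      clDer k 1 (clMul k 0 p) + clMul k 1 (clDer k 0 p) := by
  simp only [clMul_zero_apply, clMul_one_apply, clDer_zero_apply, clDer_one_apply]
  ext j : 1; fin_cases j <;> simp

variable (k)

/-- The pair `(x, y)` stands for `x + ay`, where `a² = a` and `abᵢ + bᵢa = bᵢ`; this is left
multiplication by `a`. -/
noncomputable def clIdem : Module.End k ((Fin 8 → k[X]) × (Fin 8 → k[X])) :=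
  LinearMap.inr k _ _ ∘ₗ (LinearMap.fst k _ _ + LinearMap.snd k _ _)

/-- The derivations of the pairs, with `∂ᵢa = bᵢ`. -/
noncomputable def clPairDer (i : Fin 2) : Module.End k ((Fin 8 → k[X]) × (Fin 8 → k[X])) :=
  (clDer k i ∘ₗ LinearMap.fst k _ _ + clMul k i ∘ₗ LinearMap.snd k _ _).prod
    (clDer k i ∘ₗ LinearMap.snd k _ _)

variable {k}

theorem clIdem_apply (x y : Fin 8 → k[X]) : clIdem k (x, y) = (0, x + y) := rfl

theorem clPairDer_apply (i : Fin 2) (x y : Fin 8 → k[X]) :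
    clPairDer k i (x, y) = (clDer k i x + clMul k i y, clDer k i y) := rfl

theorem clIdem_mul_self : clIdem k * clIdem k = clIdem k := by
  refine LinearMap.ext fun ⟨x, y⟩ => ?_
  rw [Module.End.mul_apply, clIdem_apply, clIdem_apply, zero_add]

theorem clPairDer_commute : Commute (clPairDer k 0) (clPairDer k 1) := by
  refine LinearMap.ext fun ⟨x, y⟩ => ?_
  simp only [Module.End.mul_apply, clPairDer_apply, map_add, clDer_comm]
  rw [add_assoc, add_assoc, clDer_clMul_symm]

/-- The inner commutator is multiplication by `∂ᵢa = bᵢ`, and `∂ᵢbᵢ = 0`. In coordinates this uses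
`bᵢ² = 0` and that `∂ᵢ` commutes with multiplication by `bᵢ`. -/
theorem clPairDer_clIdem (i : Fin 2) :
    clPairDer k i * (clPairDer k i * clIdem k - clIdem k * clPairDer k i) -
      (clPairDer k i * clIdem k - clIdem k * clPairDer k i) * clPairDer k i = 0 := by
  refine LinearMap.ext fun ⟨x, y⟩ => ?_
  simp only [Module.End.mul_apply, LinearMap.sub_apply, clPairDer_apply, clIdem_apply, map_add,
    map_zero, Prod.mk_sub_mk, zero_add, sub_zero, LinearMap.zero_apply, map_sub, clMul_clMul,
    clDer_clMul, Prod.mk_eq_zero]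
  constructor <;> abel

/-- On vectors `ax`, a letter `(1,0)` or `(0,1)` of a word acts as `bᵢ + ∂ᵢ` on `x`, so the values
of alternating words come from iterating two explicit operators. -/
theorem clIdem_clPairDer (i : Fin 2) (x : Fin 8 → k[X]) :
    clIdem k (clPairDer k i (0, x)) = (0, clMul k i x + clDer k i x) := by
  rw [clPairDer_apply, clIdem_apply, map_zero, zero_add]

/-- The values of the listed words. -/
noncomputable def clVec : Fin 8 × ℕ → (Fin 8 → k[X])
  | (0, 0) => ![1, 0, 0, 0, 0, 0, 0, 0]
  | (0, n + 1) => ![X ^ (n + 1), 0, 0, -X ^ n, X ^ n, 0, 0, 0]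
  | (1, n) => ![0, X ^ n, 0, 0, 0, 0, 0, 0]
  | (2, n) => ![0, 0, X ^ n, 0, 0, 0, 0, 0]
  | (3, n) => ![0, 0, 0, X ^ n, X ^ n, 0, 0, 0]
  | (4, 0) => ![0, 0, 0, 0, 1, 0, 0, 0]
  | (4, n + 1) => ![0, 0, 0, 0, X ^ (n + 1), 0, 0, -X ^ n]
  | (5, n) => ![0, 0, 0, 0, 0, X ^ n, 0, 0]
  | (6, n) => ![0, 0, 0, 0, 0, 0, X ^ n, 0]
  | (7, n) => ![0, 0, 0, 0, 0, 0, 0, X ^ n]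

/-- The listed words, except for the index of the last letter. -/
def clList : Fin 8 × ℕ → List (Idx 2)
  | (0, n) => alternating ![1, 0] ![0, 1] (2 * n)
  | (1, n) => alternating ![1, 0] ![0, 1] (2 * n + 1)
  | (2, n) => alternating ![0, 1] ![1, 0] (2 * n + 1)
  | (3, n) => alternating ![0, 1] ![1, 0] (2 * n + 2)
  | (4, n) => alternating ![1, 0] ![0, 1] (2 * n) ++ [![1, 1]]
  | (5, n) => alternating ![1, 0] ![0, 1] (2 * n + 1) ++ [![1, 1]]
  | (6, n) => alternating ![0, 1] ![1, 0] (2 * n + 1) ++ [![1, 1]]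
  | (7, n) => alternating ![0, 1] ![1, 0] (2 * n + 2) ++ [![1, 1]]

theorem exists_clList {l : List (Idx 2)} (h : ∃ (r : ℕ) (e : List (Idx 2)),
    (e = [] ∨ e = [![1, 1]]) ∧ (l = alternating ![1, 0] ![0, 1] r ++ e ∨
      l = alternating ![0, 1] ![1, 0] r ++ e)) : ∃ j, clList j = l := by
  obtain ⟨r, e, he, hl⟩ := h
  obtain ⟨n, rfl | rfl⟩ := Nat.even_or_odd' r
  · rcases hl with rfl | rfl
    · rcases he with rfl | rfl
      exacts [⟨(0, n), (List.append_nil _).symm⟩, ⟨(4, n), rfl⟩]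
    -- The empty alternating sequence belongs to both families. It is counted in the one starting
    -- with `(1,0)`, hence the lengths `2 * n + 2` in `clList`.
    · cases n with
      | zero =>
        rcases he with rfl | rfl
        exacts [⟨(0, 0), rfl⟩, ⟨(4, 0), rfl⟩]
      | succ n =>
        rcases he with rfl | rfl
        exacts [⟨(3, n), (List.append_nil _).symm⟩, ⟨(7, n), rfl⟩]
  · rcases hl with rfl | rfl
    · rcases he with rfl | rfl
      exacts [⟨(1, n), (List.append_nil _).symm⟩, ⟨(5, n), rfl⟩]
    · rcases he with rfl | rfl
      exacts [⟨(2, n), (List.append_nil _).symm⟩, ⟨(6, n), rfl⟩]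

/-- The value of a word in the idempotent representation. -/
noncomputable abbrev clVal (l : List (Idx 2)) : (Fin 8 → k[X]) × (Fin 8 → k[X]) :=
  wordVal (clIdem k) (clPairDer k) (clVec (0, 0), 0) l

theorem clVal_cons_zero {l : List (Idx 2)} {x : Fin 8 → k[X]} (h : clVal l = (0, x)) :
    clVal (![1, 0] :: l) = (0, clMul k 0 x + clDer k 0 x) := by
  rw [← clIdem_clPairDer, ← h]
  simp [clVal, wordVal]

theorem clVal_cons_one {l : List (Idx 2)} {x : Fin 8 → k[X]} (h : clVal l = (0, x)) :
    clVal (![0, 1] :: l) = (0, clMul k 1 x + clDer k 1 x) := by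
  rw [← clIdem_clPairDer, ← h]
  simp [clVal, wordVal]

theorem clVal_nil : clVal (k := k) [] = (0, clVec (0, 0)) := by
  simp [clVal, wordVal, clIdem_apply]

/-- The letter `(1,1)` produces `∂₁∂₂a = e`. -/
theorem clVal_one_one : clVal (k := k) [![1, 1]] = (0, clVec (4, 0)) := by
  have h : clVal (k := k) [![1, 1]] =
      clIdem k (clPairDer k 0 (clPairDer k 1 (clVal (k := k) []))) := by simp [clVal, wordVal]
  rw [h, clVal_nil, clPairDer_apply, clPairDer_apply, clIdem_apply]
  simp only [clVec, clMul_zero_apply, clMul_one_apply, clDer_zero_apply, clDer_one_apply, map_zero]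
  congr 1
  ext j : 1; fin_cases j <;> simp

/-- Prefixing `(0,1)` leads from `(0, n)` to `(2, n)`, and prefixing `(1,0)` from there to `(0, n +
1)`; each return gains a factor `X` from `b₁b₂ = X - b₂b₁`. The families `(1, 3)`, `(4, 6)` and `(5,
7)` are linked in the same way. -/
theorem clVal_even (n : ℕ) : clVal (k := k) (clList (0, n)) = (0, clVec (0, n)) ∧
    clVal (k := k) (clList (2, n)) = (0, clVec (2, n)) := by
  induction n with
  | zero =>
    refine ⟨clVal_nil, (clVal_cons_one clVal_nil).trans ?_⟩
    simp only [clVec, clMul_one_apply, clDer_one_apply]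
    congr 1
    ext j : 1; fin_cases j <;> simp
  | succ n ih =>
    have h : clVal (k := k) (clList (0, n + 1)) = (0, clVec (0, n + 1)) := by
      refine (clVal_cons_zero ih.2).trans ?_
      simp only [clVec, clMul_zero_apply, clDer_zero_apply]
      congr 1
      ext j : 1; fin_cases j <;> simp [pow_succ']
    refine ⟨h, (clVal_cons_one h).trans ?_⟩
    simp only [clVec, clMul_one_apply, clDer_one_apply]
    congr 1
    ext j : 1; fin_cases j <;> simp

theorem clVal_odd (n : ℕ) : clVal (k := k) (clList (1, n)) = (0, clVec (1, n)) ∧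
    clVal (k := k) (clList (3, n)) = (0, clVec (3, n)) := by
  induction n with
  | zero =>
    have h : clVal (k := k) (clList (1, 0)) = (0, clVec (1, 0)) := by
      refine (clVal_cons_zero clVal_nil).trans ?_
      simp only [clVec, clMul_zero_apply, clDer_zero_apply]
      congr 1
      ext j : 1; fin_cases j <;> simp
    refine ⟨h, (clVal_cons_one h).trans ?_⟩
    simp only [clVec, clMul_one_apply, clDer_one_apply]
    congr 1
    ext j : 1; fin_cases j <;> simp
  | succ n ih =>
    have h : clVal (k := k) (clList (1, n + 1)) = (0, clVec (1, n + 1)) := by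
      refine (clVal_cons_zero ih.2).trans ?_
      simp only [clVec, clMul_zero_apply, clDer_zero_apply]
      congr 1
      ext j : 1; fin_cases j <;> simp [pow_succ']
    refine ⟨h, (clVal_cons_one h).trans ?_⟩
    simp only [clVec, clMul_one_apply, clDer_one_apply]
    congr 1
    ext j : 1; fin_cases j <;> simp

theorem clVal_even_append (n : ℕ) : clVal (k := k) (clList (4, n)) = (0, clVec (4, n)) ∧
    clVal (k := k) (clList (6, n)) = (0, clVec (6, n)) := by
  induction n with
  | zero =>
    refine ⟨clVal_one_one, (clVal_cons_one clVal_one_one).trans ?_⟩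
    simp only [clVec, clMul_one_apply, clDer_one_apply]
    congr 1
    ext j : 1; fin_cases j <;> simp
  | succ n ih =>
    have h : clVal (k := k) (clList (4, n + 1)) = (0, clVec (4, n + 1)) := by
      refine (clVal_cons_zero ih.2).trans ?_
      simp only [clVec, clMul_zero_apply, clDer_zero_apply]
      congr 1
      ext j : 1; fin_cases j <;> simp [pow_succ']
    refine ⟨h, (clVal_cons_one h).trans ?_⟩
    simp only [clVec, clMul_one_apply, clDer_one_apply]
    congr 1
    ext j : 1; fin_cases j <;> simp

theorem clVal_odd_append (n : ℕ) : clVal (k := k) (clList (5, n)) = (0, clVec (5, n)) ∧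
    clVal (k := k) (clList (7, n)) = (0, clVec (7, n)) := by
  induction n with
  | zero =>
    have h : clVal (k := k) (clList (5, 0)) = (0, clVec (5, 0)) := by
      refine (clVal_cons_zero clVal_one_one).trans ?_
      simp only [clVec, clMul_zero_apply, clDer_zero_apply]
      congr 1
      ext j : 1; fin_cases j <;> simp
    refine ⟨h, (clVal_cons_one h).trans ?_⟩
    simp only [clVec, clMul_one_apply, clDer_one_apply]
    congr 1
    ext j : 1; fin_cases j <;> simp
  | succ n ih =>
    have h : clVal (k := k) (clList (5, n + 1)) = (0, clVec (5, n + 1)) := by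
      refine (clVal_cons_zero ih.2).trans ?_
      simp only [clVec, clMul_zero_apply, clDer_zero_apply]
      congr 1
      ext j : 1; fin_cases j <;> simp [pow_succ']
    refine ⟨h, (clVal_cons_one h).trans ?_⟩
    simp only [clVec, clMul_one_apply, clDer_one_apply]
    congr 1
    ext j : 1; fin_cases j <;> simp

theorem clVal_clList : ∀ j, clVal (k := k) (clList j) = (0, clVec j)
  | (0, n) => (clVal_even n).1
  | (1, n) => (clVal_odd n).1
  | (2, n) => (clVal_even n).2
  | (3, n) => (clVal_odd n).2
  | (4, n) => (clVal_even_append n).1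
  | (5, n) => (clVal_odd_append n).1
  | (6, n) => (clVal_even_append n).2
  | (7, n) => (clVal_odd_append n).2

/-- The functionals dual to `clVec`. -/
noncomputable def clDual : Fin 8 × ℕ → (Fin 8 → k[X]) → k
  | (0, n), p => (p 0).coeff n
  | (1, n), p => (p 1).coeff n
  | (2, n), p => (p 2).coeff n
  | (3, n), p => (p 3).coeff n + (p 0).coeff (n + 1)
  | (4, n), p => (p 4).coeff n - (p 3).coeff n - 2 * (p 0).coeff (n + 1)
  | (5, n), p => (p 5).coeff n
  | (6, n), p => (p 6).coeff n
  | (7, n), p => (p 7).coeff n + ((p 4).coeff (n + 1) - (p 3).coeff (n + 1) -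
      2 * (p 0).coeff (n + 2))

theorem clDual_sum (j : Fin 8 × ℕ) (s : Finset (Fin 8 × ℕ)) (g : Fin 8 × ℕ → k)
    (v : Fin 8 × ℕ → (Fin 8 → k[X])) :
    clDual j (∑ i ∈ s, g i • v i) = ∑ i ∈ s, g i * clDual j (v i) := by
  obtain ⟨j, n⟩ := j
  have hadd : ∀ p q : Fin 8 → k[X], clDual (j, n) (p + q) = clDual (j, n) p + clDual (j, n) q := by
    intro p q
    fin_cases j <;> simp [clDual] <;> ring
  have hsmul : ∀ (c : k) (p : Fin 8 → k[X]), clDual (j, n) (c • p) = c * clDual (j, n) p := by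
    intro c p
    fin_cases j <;> simp [clDual] <;> ring
  classical
  induction s using Finset.induction_on with
  | empty => simpa using hsmul 0 0
  | insert a s ha ih => rw [Finset.sum_insert ha, Finset.sum_insert ha, hadd, hsmul, ih]

theorem clDual_clVec (i j : Fin 8 × ℕ) : clDual (k := k) j (clVec i) = if i = j then 1 else 0 := by
  obtain ⟨i, m⟩ := i
  obtain ⟨j, n⟩ := j
  fin_cases i <;> fin_cases j <;> cases m <;>
    simp [clDual, clVec, coeff_X_pow, coeff_one, eq_comm] <;> (try split_ifs) <;> (try simp_all) <;>
    norm_num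

/-- The powers of `X` separate the lengths and the eight coordinates separate the types of words;
the correction terms are absorbed in the dual functionals. -/
theorem linearIndependent_clVec : LinearIndependent k (clVec (k := k)) := by
  rw [linearIndependent_iff']
  intro s g hg j hj
  have h := congrArg (clDual j) hg
  rw [clDual_sum, Finset.sum_congr rfl fun i _ => by rw [clDual_clVec]] at h
  have h0 : clDual j (0 : Fin 8 → k[X]) = 0 := by simpa using clDual_sum j ∅ (0 : Fin 8 × ℕ → k) clVec
  rw [h0] at h
  simpa [hj] using h

end Idempotent

/-! ### Spans of words and presentations. -/

section Presentations

variable {k : Type*} [Field k] {n : ℕ} {B : Type*} {N : Idx n}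

theorem mem_wordSpan_iff {P : Word n B → Prop} {x : Conf k B N} :
    x ∈ wordSpan k N P ↔ ∃ c, Presents c x ∧ ∀ w ∈ c.support, P w := by
  rw [wordSpan, Finsupp.mem_span_image_iff_linearCombination]
  constructor
  · rintro ⟨c, hc, rfl⟩
    rw [Finsupp.mem_supported] at hc
    exact ⟨c, ⟨fun w hw => (hc hw).1, rfl⟩, fun w hw => (hc hw).2⟩
  · rintro ⟨c, ⟨h1, h2⟩, h3⟩
    exact ⟨c, (Finsupp.mem_supported _ _).2 fun w hw => ⟨h1 w hw, h3 w hw⟩, h2.symm⟩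

theorem isDFree_iff {x : Conf k B N} : IsDFree x ↔ x ∈ wordSpan k N fun w => w.ind = 0 :=
  mem_wordSpan_iff.symm

theorem hasLead_of_sub_mem [LinearOrder B] {x : Conf k B N} {t : Word n B} (ht : t.IsNormal N)
    (h : x - ev t ∈ wordSpan k N fun u => u.lt t) : HasLead x t 1 := by
  classical
  obtain ⟨c, ⟨h1, h2⟩, h3⟩ := mem_wordSpan_iff.1 h
  have hsupp : ∀ u ∈ (c + Finsupp.single t 1).support, u = t ∨ u ∈ c.support := by
    intro u hu
    rcases Finset.mem_union.1 (Finsupp.support_add hu) with hu | hu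
    · exact Or.inr hu
    · exact Or.inl (Finset.mem_singleton.1 (Finsupp.support_single_subset hu))
  refine ⟨c + Finsupp.single t 1, ⟨fun u hu => ?_, ?_⟩, ?_, one_ne_zero,
    fun u hu => (hsupp u hu).imp_right (h3 u)⟩
  · rcases hsupp u hu with rfl | hu
    exacts [ht, h1 u hu]
  · rw [Finsupp.sum_add_index' (h := fun w r => r • (ev w : Conf k B N)) (fun _ => zero_smul _ _)
      (fun _ _ _ => add_smul _ _ _), ← h2, Finsupp.sum_single_index (h := fun w r => r • (ev w : Conf k B N)) (zero_smul _ _), one_smul, sub_add_cancel]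
  · have : c t = 0 := by
      by_contra h0
      exact Word.lt_irrefl t (h3 t (Finsupp.mem_support_iff.2 h0))
    simp [this]

end Presentations

/-! ### Uniqueness of leading words; consequences of idempotency. -/

section TwoVariables

variable {k : Type*} [Field k]

theorem Presents.unique [CharZero k] {c c' : Word 2 Unit →₀ k} {x : Conf k Unit ![2, 2]}
    (h : Presents c x) (h' : Presents c' x) : c = c' := by
  have hl : LinearIndepOn k (fun w => (ev w : Conf k Unit ![2, 2]))
      {w : Word 2 Unit | w.IsNormal ![2, 2]} := linearIndependent_ev
  exact linearIndepOn_iffₛ.1 hl c ((Finsupp.mem_supported _ _).2 h.1) c'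
    ((Finsupp.mem_supported _ _).2 h'.1) (h.2.symm.trans h'.2)

theorem HasLead.unique [CharZero k] {x : Conf k Unit ![2, 2]} {t t' : Word 2 Unit} {r r' : k}
    (h : HasLead x t r) (h' : HasLead x t' r') : t = t' := by
  obtain ⟨c, hc, hr, hr0, hlt⟩ := h
  obtain ⟨c', hc', hr', hr0', hlt'⟩ := h'
  obtain rfl := hc.unique hc'
  rcases hlt t' (Finsupp.mem_support_iff.2 (hr' ▸ hr0')) with h1 | h1
  · exact h1.symm
  rcases hlt' t (Finsupp.mem_support_iff.2 (hr ▸ hr0)) with h2 | h2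
  · exact h2
  · exact absurd (Word.lt_trans h1 h2) (Word.lt_irrefl _)

/-! The relations that follow from `a⟨0,0⟩a = a`. -/

theorem triple_relation {m : Idx 2} (hm : ¬ Below m ![2, 2]) (p : Idx 2) :
    (∑ s ∈ Finset.Iic m, coeff k m s • op k (m - s) (gen _ () : Conf k Unit ![2, 2])
      (op k (p + s) (gen _ ()) (gen _ ()))) = 0 := by
  rw [← free_assoc, free_gen_local _ _ _ m hm, map_zero, LinearMap.zero_apply]

/-- Linear algebra in the quotient for the classes `X m p` of `a⟨m⟩a⟨p⟩a`. They vanish for `p`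
outside the locality, and, since `a⟨m⟩f` lies in the ideal, for `p = 0` and `m` outside the
locality. The remaining relations are those of associativity. -/
theorem consequences_mem [CharZero k] {I : Submodule k (Conf k Unit ![2, 2])}
    (hI : IsConformalIdeal k 2 I)
    (hf : op k ![0, 0] (gen _ () : Conf k Unit ![2, 2]) (gen _ ()) - gen _ () ∈ I) :
    op k ![1, 0] (gen _ ()) (op k ![1, 0] (gen _ ()) (gen _ ())) ∈ I ∧
    op k ![0, 1] (gen _ ()) (op k ![0, 1] (gen _ ()) (gen _ ())) ∈ I ∧
    op k ![1, 1] (gen _ ()) (op k ![1, 0] (gen _ ()) (gen _ ())) ∈ I ∧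
    op k ![1, 1] (gen _ ()) (op k ![0, 1] (gen _ ()) (gen _ ())) ∈ I ∧
    op k ![1, 1] (gen _ ()) (op k ![1, 1] (gen _ ()) (gen _ ())) ∈ I := by
  set a : Conf k Unit ![2, 2] := gen _ () with ha
  set X : Idx 2 → Idx 2 → (Conf k Unit ![2, 2] ⧸ I) := fun m p => I.mkQ (op k m a (op k p a a))
    with hX
  have hbad : ∀ i j : ℕ, 2 ≤ i ∨ 2 ≤ j → ¬ Below ![i, j] ![2, 2] := by
    intro i j h hb
    have h0 : i < 2 := hb 0
    have h1 : j < 2 := hb 1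
    omega
  have hloc : ∀ i j : ℕ, 2 ≤ i ∨ 2 ≤ j → op k ![i, j] a a = 0 := fun i j h =>
    free_gen_local _ _ _ _ (hbad i j h)
  have hX0 : ∀ (m : Idx 2) (i j : ℕ), 2 ≤ i ∨ 2 ≤ j → X m ![i, j] = 0 := by
    intro m i j h
    simp only [hX, hloc i j h, map_zero]
  have hX1 : ∀ i j : ℕ, 2 ≤ i ∨ 2 ≤ j → X ![i, j] ![0, 0] = 0 := by
    intro i j h
    have h1 := hI.op_left ![i, j] a _ hf
    rw [map_sub, hloc i j h, sub_zero] at h1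
    exact (Submodule.Quotient.mk_eq_zero I).2 h1
  have hrel : ∀ i j p q : ℕ, 2 ≤ i ∨ 2 ≤ j →
      ∑ s ∈ Finset.range (i + 1), ((-1) ^ s * (i.choose s : k)) •
        ∑ t ∈ Finset.range (j + 1), ((-1) ^ t * (j.choose t : k)) •
          X ![i - s, j - t] ![p + s, q + t] = 0 := by
    intro i j p q h
    have h1 := congrArg I.mkQ (triple_relation (k := k) (hbad i j h) ![p, q])
    simp only [map_sum, map_smul, map_zero] at h1
    rw [sum_coeff_two (fun m s => X m (![p, q] + s))] at h1
    simpa using h1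
  have e1 := hrel 2 0 0 0 (by simp)
  have e2 := hrel 0 2 0 0 (by simp)
  have e3 := hrel 2 0 0 1 (by simp)
  have e4 := hrel 0 2 1 0 (by simp)
  have e5 := hrel 2 1 0 0 (by simp)
  have e6 := hrel 1 2 0 0 (by simp)
  have e7 := hrel 1 2 1 0 (by simp)
  have e8 := hrel 2 1 0 1 (by simp)
  have e9 := hrel 2 2 0 0 (by simp)
  simp [Finset.sum_range_succ, hX0, hX1] at e1 e2 e3 e4 e5 e6 e7 e8 e9
  -- `e5` reads `-2X(11;10) - X(20;01) + 2X(10;11) = 0` and `e3` reads `X(20;01) = 2X(10;11)`.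
  have f1 : (2 : k) • X ![1, 1] ![1, 0] = 0 := by
    linear_combination (norm := module) (-1 : k) • e5 + (-1 : k) • e3
  have f2 : (2 : k) • X ![1, 1] ![0, 1] = 0 := by
    linear_combination (norm := module) (-1 : k) • e6 + (-1 : k) • e4
  -- `e8` and `e7` identify `X(21;01)` and `X(12;10)` with `2X(11;11)`. Then `e9`, that is
  -- `4X(11;11) - 2X(12;10) - 2X(21;01) = 0`, becomes `-4X(11;11) = 0`.
  have f3 : (4 : k) • X ![1, 1] ![1, 1] = 0 := by
    linear_combination (norm := module) (-1 : k) • e9 + (-2 : k) • e8 + (-2 : k) • e7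
  have h2 : (2 : k) ≠ 0 := two_ne_zero
  have h4 : (4 : k) ≠ 0 := by norm_num
  have hmem : ∀ m p : Idx 2, X m p = 0 → op k m a (op k p a a) ∈ I := fun m p h =>
    (Submodule.Quotient.mk_eq_zero I).1 h
  exact ⟨hmem _ _ e1, hmem _ _ e2, hmem _ _ ((smul_eq_zero.1 f1).resolve_left h2),
    hmem _ _ ((smul_eq_zero.1 f2).resolve_left h2), hmem _ _ ((smul_eq_zero.1 f3).resolve_left h4)⟩

end TwoVariables

/-! The words avoiding the leading words of the Gröbner–Shirshov basis. -/

section Patterns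

/-- The multi-indices of the leading words of the Gröbner–Shirshov basis. -/
def patterns : List (List (Idx 2)) :=
  [[![0, 0]], [![1, 0], ![1, 0]], [![0, 1], ![0, 1]], [![1, 1], ![1, 0]], [![1, 1], ![0, 1]],
    [![1, 1], ![1, 1]]]

/-- The sequences of multi-indices that avoid the patterns. -/
def Avoids (l : List (Idx 2)) : Prop :=
  l.IsChain (fun m p => m ≠ ![1, 1] ∧ m ≠ p) ∧
    ∀ m ∈ l, m = ![1, 0] ∨ m = ![0, 1] ∨ m = ![1, 1]

/-- The possibly empty alternating sequences of `(1,0)` and `(0,1)`, possibly followed by `(1,1)`. -/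
def IsListedSeq (l : List (Idx 2)) : Prop :=
  ∃ (r : ℕ) (e : List (Idx 2)), (e = [] ∨ e = [![1, 1]]) ∧
    (l = alternating ![1, 0] ![0, 1] r ++ e ∨ l = alternating ![0, 1] ![1, 0] r ++ e)

theorem below_two_iff {m : Idx 2} : Below m ![2, 2] ↔
    m = ![0, 0] ∨ m = ![1, 0] ∨ m = ![0, 1] ∨ m = ![1, 1] := by
  constructor
  · intro h
    have h0 : m 0 < 2 := h 0
    have h1 : m 1 < 2 := h 1
    have hm : m = ![m 0, m 1] := by funext i; fin_cases i <;> rfl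
    rw [hm]
    interval_cases m 0 <;> interval_cases m 1 <;> simp
  · rintro (rfl | rfl | rfl | rfl) i <;> fin_cases i <;> simp

theorem below_of_mem_patterns {T : List (Idx 2)} (hT : T ∈ patterns) : ∀ m ∈ T, Below m ![2, 2] := by
  intro m hm
  simp only [patterns, List.mem_cons, List.not_mem_nil, or_false] at hT
  rw [below_two_iff]
  rcases hT with rfl | rfl | rfl | rfl | rfl | rfl <;> simp at hm <;> tauto

theorem Avoids.of_append {l₁ T l₂ : List (Idx 2)} (h : Avoids (l₁ ++ T ++ l₂)) : Avoids T := by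
  refine ⟨h.1.infix ⟨l₁, l₂, rfl⟩, fun m hm => h.2 m ?_⟩
  simp [hm]

theorem not_avoids_of_mem_patterns {T : List (Idx 2)} (hT : T ∈ patterns) : ¬ Avoids T := by
  rintro ⟨h1, h2⟩
  simp only [patterns, List.mem_cons, List.not_mem_nil, or_false] at hT
  rcases hT with rfl | rfl | rfl | rfl | rfl | rfl
  · simpa using h2 ![0, 0] (by simp)
  all_goals simp at h1

/-- Excluding `(0,0)` leaves three letters. The five patterns of length two are exactly the pairs of
these that violate the chain condition. -/
theorem avoids_of_forall_patterns {l : List (Idx 2)} (hl : ∀ m ∈ l, Below m ![2, 2])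
    (h : ∀ T ∈ patterns, ∀ l₁ l₂, l ≠ l₁ ++ T ++ l₂) : Avoids l := by
  induction l with
  | nil => exact ⟨List.IsChain.nil, by simp⟩
  | cons m l ih =>
    have ih' := ih (fun p hp => hl p (List.mem_cons_of_mem _ hp))
      fun T hT l₁ l₂ heq => h T hT (m :: l₁) l₂ (by rw [heq]; rfl)
    have hm : m = ![1, 0] ∨ m = ![0, 1] ∨ m = ![1, 1] := by
      refine (below_two_iff.1 (hl m List.mem_cons_self)).resolve_left ?_
      rintro rfl
      exact h [![0, 0]] (by simp [patterns]) [] l rfl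
    refine ⟨?_, fun p hp => ?_⟩
    · cases l with
      | nil => exact List.isChain_singleton _
      | cons q l =>
        rw [List.isChain_cons_cons]
        refine ⟨?_, ih'.1⟩
        have hq := ih'.2 q List.mem_cons_self
        have hpat : [m, q] ∉ patterns := fun hT => h _ hT [] l rfl
        constructor
        · rintro rfl
          rcases hq with rfl | rfl | rfl <;> simp [patterns] at hpat
        · rintro rfl
          rcases hm with rfl | rfl | rfl <;> simp [patterns] at hpat
    · rcases List.mem_cons.1 hp with rfl | hp
      exacts [hm, ih'.2 p hp]

/-- A new first letter must differ from the next one, so it prolongs the alternation; `(1,1)` has no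
admissible successor and can only be last. -/
theorem Avoids.isListedSeq {l : List (Idx 2)} (h : Avoids l) : IsListedSeq l := by
  induction l with
  | nil => exact ⟨0, [], Or.inl rfl, Or.inl rfl⟩
  | cons m l ih =>
    obtain ⟨r, e, he, hl⟩ := ih ⟨h.1.tail, fun p hp => h.2 p (List.mem_cons_of_mem _ hp)⟩
    rcases h.2 m List.mem_cons_self with rfl | rfl | rfl
    · rcases hl with rfl | rfl
      · cases r with
        | zero => exact ⟨1, e, he, Or.inl rfl⟩
        | succ r =>
          have := h.1
          simp [alternating] at this
      · exact ⟨r + 1, e, he, Or.inl rfl⟩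
    · rcases hl with rfl | rfl
      · exact ⟨r + 1, e, he, Or.inr rfl⟩
      · cases r with
        | zero => exact ⟨1, e, he, Or.inr rfl⟩
        | succ r =>
          have := h.1
          simp [alternating] at this
    · cases l with
      | nil => exact ⟨0, [![1, 1]], Or.inr rfl, Or.inl rfl⟩
      | cons q l => exact absurd rfl (List.isChain_cons_cons.1 h.1).1.1

theorem avoids_alternating {x y : Idx 2} (hx : x = ![1, 0] ∨ x = ![0, 1])
    (hy : y = ![1, 0] ∨ y = ![0, 1]) (hxy : x ≠ y) {e : List (Idx 2)}
    (he : e = [] ∨ e = [![1, 1]]) (r : ℕ) : Avoids (alternating x y r ++ e) := by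
  induction r generalizing x y with
  | zero => rcases he with rfl | rfl <;> exact ⟨by simp [alternating], by simp [alternating]⟩
  | succ r ih =>
    have ih' := ih hy hx hxy.symm
    have hx1 : x ≠ ![1, 1] := by rcases hx with rfl | rfl <;> simp
    refine ⟨?_, fun m hm => ?_⟩
    · have : alternating x y (r + 1) ++ e = x :: (alternating y x r ++ e) := rfl
      rw [this]
      cases r with
      | zero => rcases he with rfl | rfl <;> simp [alternating, hx1]
      | succ r => exact List.isChain_cons_cons.2 ⟨⟨hx1, hxy⟩, ih'.1⟩
    · rcases List.mem_cons.1 hm with rfl | hm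
      · exact hx.imp_right Or.inl
      · exact ih'.2 m hm

theorem IsListedSeq.avoids {l : List (Idx 2)} (h : IsListedSeq l) : Avoids l := by
  obtain ⟨r, e, he, rfl | rfl⟩ := h
  exacts [avoids_alternating (Or.inl rfl) (Or.inr rfl) (by simp) he r,
    avoids_alternating (Or.inr rfl) (Or.inl rfl) (by simp) he r]

/-- The word on one letter with given multi-indices. -/
def seqWord (l : List (Idx 2)) (i : Idx 2) : Word 2 Unit := ⟨l.map (Prod.mk ()), (), i⟩

theorem seqWord_map (w : Word 2 Unit) : seqWord (w.init.map Prod.snd) w.ind = w := by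
  obtain ⟨l, ⟨⟩, i⟩ := w
  simp only [seqWord, List.map_map]
  congr 1
  exact List.map_id' l

theorem isNormal_seqWord {l : List (Idx 2)} {i : Idx 2} :
    (seqWord l i).IsNormal ![2, 2] ↔ ∀ m ∈ l, Below m ![2, 2] := by
  simp [seqWord, Word.IsNormal]

theorem isListed_seqWord {l : List (Idx 2)} {i : Idx 2} :
    IsListed (seqWord l i) ↔ IsListedSeq l := by
  have : (l.map (Prod.mk ())).map Prod.snd = l := by
    rw [List.map_map]
    exact List.map_id' l
  simp only [IsListed, IsListedSeq, seqWord, this]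

theorem IsListed.isNormal {w : Word 2 Unit} (h : IsListed w) : w.IsNormal ![2, 2] := by
  rw [← seqWord_map w, isListed_seqWord] at h
  rw [← seqWord_map w, isNormal_seqWord]
  intro m hm
  rw [below_two_iff]
  exact Or.inr (h.avoids.2 m hm)

end Patterns

/-! ### Reduction modulo `S` and triviality of the compositions. -/

section GroebnerShirshov

variable {k : Type*} [Field k]

/-- The leading word of `s` is given by `T`, and the other ones are shorter and D-free. -/
def HasPattern (s : Conf k Unit ![2, 2]) (T : List (Idx 2)) : Prop :=
  s - ev (seqWord T 0) ∈ wordSpan k ![2, 2] fun u => u.length < (seqWord T 0).length ∧ u.ind = 0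

variable {s : Conf k Unit ![2, 2]} {T : List (Idx 2)}

theorem HasPattern.hasLead (h : HasPattern s T) (hT : T ∈ patterns) :
    HasLead s (seqWord T 0) 1 :=
  hasLead_of_sub_mem (isNormal_seqWord.2 (below_of_mem_patterns hT))
    (wordSpan_mono (fun _ _ h => Word.lt_of_length_lt h.1) h)

theorem HasPattern.mem_wordSpan (h : HasPattern s T) (hT : T ∈ patterns) :
    s ∈ wordSpan k ![2, 2] fun u => u.ind = 0 := by
  rw [← sub_add_cancel s (ev (seqWord T 0))]
  exact add_mem (wordSpan_mono (fun _ _ h => h.2) h)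
    (ev_mem_wordSpan (isNormal_seqWord.2 (below_of_mem_patterns hT)) rfl)

theorem HasPattern.op_sub_mem (h : HasPattern s T) (hT : T ∈ patterns) (d : Prop) (m : Idx 2)
    {b : Word 2 Unit} (hb : b.IsNormal ![2, 2]) (hd : d → b.ind = 0) :
    op k m s (ev b) - ev ((seqWord T 0).append m b) ∈
      wordSpan k ![2, 2] fun u => u.lt ((seqWord T 0).append m b) ∧ (d → u.ind = 0) := by
  have h1 := op_ev_sub_mem (k := k) d (isNormal_seqWord.2 (below_of_mem_patterns hT))
    (rfl : (seqWord T 0).ind = 0) (m := m) hb hd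
  -- The rest of `s` is strictly shorter, and products add lengths, so it cannot reach the leading
  -- word.
  have h2 : op k m (s - ev (seqWord T 0)) (ev b) ∈
      wordSpan k ![2, 2] fun u => u.lt ((seqWord T 0).append m b) ∧ (d → u.ind = 0) := by
    refine map_mem_of_wordSpan ((op k m).flip (ev b)) (fun u hu hlt => ?_) h
    refine wordSpan_mono (fun v _ hv => ⟨Word.lt_of_length_lt ?_, hv.2⟩)
      (op_ev_mem_wordSpan d u m (ev_mem_wordSpan
        (P := fun w => w.length = b.length ∧ (d → w.ind = 0)) hb ⟨rfl, hd⟩))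
    have h3 := hv.1
    have h4 := hlt.1
    simp only [Word.length, Word.append, List.length_append, List.length_cons] at *
    omega
  rw [map_sub, LinearMap.sub_apply] at h2
  simpa using add_mem h2 h1

theorem HasPattern.derPow_sub_mem (h : HasPattern s T) (hT : T ∈ patterns) (i : Idx 2) :
    derPow k i s - ev ((seqWord T 0).shift i) ∈
      wordSpan k ![2, 2] fun u => u.lt ((seqWord T 0).shift i) :=
  NConformal.derPow_sub_mem i (isNormal_seqWord.2 (below_of_mem_patterns hT))
    (wordSpan_mono (fun _ _ h => Word.lt_of_length_lt h.1) h)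

theorem lmul_sub_mem {x : Conf k Unit ![2, 2]} {w : Word 2 Unit} {d : Prop}
    (hx : x - ev w ∈ wordSpan k ![2, 2] fun u => u.lt w ∧ (d → u.ind = 0))
    {L : List (Unit × Idx 2)} (hL : IsPrefix ![2, 2] L) :
    lmul L x - ev (w.prepend L) ∈
      wordSpan k ![2, 2] fun u => u.lt (w.prepend L) ∧ (d → u.ind = 0) := by
  rw [ev_prepend, ← lmul_sub]
  exact lmul_mem_wordSpan_lt hL hx

theorem isDFree_of_sub_mem {x : Conf k Unit ![2, 2]} {w : Word 2 Unit} (hw : w.IsNormal ![2, 2])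
    (h0 : w.ind = 0) (hx : x - ev w ∈ wordSpan k ![2, 2] fun u => u.lt w ∧ (w.ind = 0 → u.ind = 0)) :
    IsDFree x := by
  rw [isDFree_iff, ← sub_add_cancel x (ev w)]
  exact add_mem (wordSpan_mono (fun _ _ h => h.2 h0) hx) (ev_mem_wordSpan hw h0)

/-- A system of elements with the leading words given by the patterns. -/
structure IsPatternSystem (S : Set (Conf k Unit ![2, 2])) : Prop where
  hasPattern : ∀ s ∈ S, ∃ T ∈ patterns, HasPattern s T
  exists_mem : ∀ T ∈ patterns, ∃ s ∈ S, HasPattern s T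

variable {S : Set (Conf k Unit ![2, 2])}

/-- A normal word that is not listed is the leading word of a normal `S`-word. -/
theorem IsPatternSystem.exists_normalSWord (hS : IsPatternSystem S) {w : Word 2 Unit}
    (hw : w.IsNormal ![2, 2]) (hl : ¬ IsListed w) :
    ∃ y, IsNormalSWord S y w ∧ (w.ind = 0 → IsDFree y) ∧
      y - ev w ∈ wordSpan k ![2, 2] fun u => u.lt w ∧ (w.ind = 0 → u.ind = 0) := by
  obtain ⟨l, i, rfl⟩ : ∃ l i, w = seqWord l i := ⟨_, _, (seqWord_map w).symm⟩
  rw [isListed_seqWord] at hl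
  obtain ⟨T, hT, l₁, l₂, rfl⟩ : ∃ T ∈ patterns, ∃ l₁ l₂, l = l₁ ++ T ++ l₂ := by
    by_contra! h
    exact hl (avoids_of_forall_patterns (isNormal_seqWord.1 hw) h).isListedSeq
  obtain ⟨s, hs, hsT⟩ := hS.exists_mem T hT
  have hn := isNormal_seqWord.1 hw
  have hL : IsPrefix ![2, 2] (l₁.map (Prod.mk ())) := by
    intro x hx
    obtain ⟨m, hm, rfl⟩ := List.mem_map.1 hx
    exact hn m (by simp [hm])
  -- If nothing follows the pattern, the derivations act on `s` itself and the second form of normal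
  -- `S`-words applies; otherwise they act on the last letter of `b` in the first form.
  cases l₂ with
  | nil =>
    have heq : seqWord (l₁ ++ T ++ []) i = ((seqWord T 0).shift i).prepend (l₁.map (Prod.mk ())) := by
      simp [seqWord, Word.shift, Word.prepend]
    have key : lmul (l₁.map (Prod.mk ())) (derPow k i s) - ev (seqWord (l₁ ++ T ++ []) i) ∈
        wordSpan k ![2, 2] fun u => u.lt (seqWord (l₁ ++ T ++ []) i) ∧
          ((seqWord (l₁ ++ T ++ []) i).ind = 0 → u.ind = 0) := by
      rw [heq]
      refine lmul_sub_mem ?_ hL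
      by_cases hi : i = 0
      · subst hi
        have hT0 : (seqWord T 0).shift 0 = seqWord T 0 := by simp [Word.shift]
        rw [derPow_zero, hT0]
        exact wordSpan_mono (fun _ _ h => ⟨Word.lt_of_length_lt h.1, fun _ => h.2⟩) hsT
      · refine wordSpan_mono (fun u _ h => ⟨h, fun h0 => absurd ?_ hi⟩) (hsT.derPow_sub_mem hT i)
        simpa [Word.prepend, Word.shift, seqWord] using h0
    exact ⟨_, ⟨s, hs, _, hsT.hasLead hT, _, hL, Or.inr ⟨i, rfl, heq⟩⟩,
      fun h0 => isDFree_of_sub_mem hw h0 key, key⟩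
  | cons m l₂ =>
    have heq : seqWord (l₁ ++ T ++ m :: l₂) i =
        ((seqWord T 0).append m (seqWord l₂ i)).prepend (l₁.map (Prod.mk ())) := by
      simp [seqWord, Word.append, Word.prepend]
    have hm : Below m ![2, 2] := hn m (by simp)
    have hb : (seqWord l₂ i).IsNormal ![2, 2] :=
      isNormal_seqWord.2 fun p hp => hn p (by simp [hp])
    have key : lmul (l₁.map (Prod.mk ())) (op k m s (ev (seqWord l₂ i))) -
        ev (seqWord (l₁ ++ T ++ m :: l₂) i) ∈
        wordSpan k ![2, 2] fun u => u.lt (seqWord (l₁ ++ T ++ m :: l₂) i) ∧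
          ((seqWord (l₁ ++ T ++ m :: l₂) i).ind = 0 → u.ind = 0) := by
      rw [heq]
      exact lmul_sub_mem (hsT.op_sub_mem hT _ m hb fun h0 => h0) hL
    exact ⟨_, ⟨s, hs, _, hsT.hasLead hT, _, hL, Or.inl ⟨isDFree_iff.2 (hsT.mem_wordSpan hT), m,
      _, hm, hb, rfl, heq⟩⟩, fun h0 => isDFree_of_sub_mem hw h0 key, key⟩

/-- Reduction modulo `S` to a combination of listed words. -/
theorem IsPatternSystem.mem_sup (hS : IsPatternSystem S) {P : Word 2 Unit → Prop} {d : Prop}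
    (hP : ∀ u w, u.IsNormal ![2, 2] → P w → u.lt w → P u) {x : Conf k Unit ![2, 2]}
    (hx : x ∈ wordSpan k ![2, 2] fun w => P w ∧ (d → w.ind = 0)) :
    x ∈ Submodule.span k {y | ∃ u, IsNormalSWord S y u ∧ P u ∧ (d → IsDFree y)} ⊔
      Submodule.span k (ev '' {w | IsListed w}) := by
  refine wordSpan_le (fun w => ?_) hx
  induction w using (Word.lt_wf (n := 2) (B := Unit)).induction with
  | h w ih =>
  intro hw ⟨hPw, hd⟩
  by_cases hl : IsListed w
  · exact Submodule.mem_sup_right (Submodule.subset_span ⟨w, hl, rfl⟩)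
  obtain ⟨y, hy, hy0, hsub⟩ := hS.exists_normalSWord hw hl
  -- Replace the word by its normal `S`-word; the difference consists of smaller words, to which the
  -- induction applies.
  rw [← sub_sub_cancel y (ev w)]
  refine sub_mem (Submodule.mem_sup_left (Submodule.subset_span ⟨w, hy, hPw, fun h => hy0 (hd h)⟩))
    (wordSpan_le (fun u hu h => ?_) hsub)
  exact ih u h.1 hu ⟨hP u w hu hPw h.1, fun h' => h.2 (hd h')⟩

theorem lmul_mem {I : Submodule k (Conf k Unit ![2, 2])} (hI : IsConformalIdeal k 2 I)
    (L : List (Unit × Idx 2)) {x : Conf k Unit ![2, 2]} (hx : x ∈ I) : lmul L x ∈ I := by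
  induction L with
  | nil => exact hx
  | cons p L ih => exact hI.op_left _ _ _ ih

theorem derPow_mem {I : Submodule k (Conf k Unit ![2, 2])} (hI : IsConformalIdeal k 2 I)
    (i : Idx 2) {x : Conf k Unit ![2, 2]} (hx : x ∈ I) : derPow k i x ∈ I := by
  induction i using idx_induction with
  | h0 => rwa [derPow_zero]
  | hs i j ih =>
    rw [derPow_add_single]
    exact hI.der_mem j _ ih

theorem IsNormalSWord.mem {I : Submodule k (Conf k Unit ![2, 2])} (hI : IsConformalIdeal k 2 I)
    (hS : S ⊆ I) {y : Conf k Unit ![2, 2]} {u : Word 2 Unit} (h : IsNormalSWord S y u) : y ∈ I := by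
  obtain ⟨s, hs, t, -, L, -, ⟨-, m, b, -, -, rfl, -⟩ | ⟨i, rfl, -⟩⟩ := h
  · exact lmul_mem hI L (hI.op_right m _ (hS hs) _)
  · exact lmul_mem hI L (derPow_mem hI i (hS hs))

variable {I : Submodule k (Conf k Unit ![2, 2])}

/-- An element of the ideal is a combination of normal `S`-words with leading words among those
below its own ones. -/
theorem IsPatternSystem.mem_span (hS : IsPatternSystem S) (hI : IsConformalIdeal k 2 I)
    (hSI : S ⊆ I) (hdisj : Disjoint (Submodule.span k (ev '' {w | IsListed w})) I)
    {P : Word 2 Unit → Prop} {d : Prop}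
    (hP : ∀ u w, u.IsNormal ![2, 2] → P w → u.lt w → P u) {x : Conf k Unit ![2, 2]} (hxI : x ∈ I)
    (hx : x ∈ wordSpan k ![2, 2] fun w => P w ∧ (d → w.ind = 0)) :
    x ∈ Submodule.span k {y | ∃ u, IsNormalSWord S y u ∧ P u ∧ (d → IsDFree y)} := by
  obtain ⟨y, hy, z, hz, rfl⟩ := Submodule.mem_sup.1 (hS.mem_sup hP hx)
  have hyI : y ∈ I := by
    refine Submodule.span_le.2 ?_ hy
    rintro y ⟨u, hu, -⟩
    exact hu.mem hI hSI
  -- The listed part of an element of the ideal lies in the ideal, hence is zero.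
  have hzI : z ∈ I := by simpa using sub_mem hxI hyI
  rw [Submodule.disjoint_def.1 hdisj z hz hzI, add_zero]
  exact hy

/-- Two monic elements of the ideal with the same leading word `w` differ by an element of the ideal
supported on words below `w`. All those words are D-free, so triviality holds in its strong form for
any `d`. -/
theorem IsPatternSystem.trivialBelow (hS : IsPatternSystem S) (hI : IsConformalIdeal k 2 I)
    (hSI : S ⊆ I) (hdisj : Disjoint (Submodule.span k (ev '' {w | IsListed w})) I)
    {w : Word 2 Unit} {x y : Conf k Unit ![2, 2]} (hx : x ∈ I) (hy : y ∈ I)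
    (hx' : x - ev w ∈ wordSpan k ![2, 2] fun u => u.lt w ∧ (True → u.ind = 0))
    (hy' : y - ev w ∈ wordSpan k ![2, 2] fun u => u.lt w ∧ (True → u.ind = 0)) (d : Prop) :
    TrivialBelow S w d (x - y) := by
  have h := hS.mem_span (P := fun u => u.lt w) (d := True) hI hSI hdisj
    (fun u v _ hv hlt => Word.lt_trans hlt hv) (sub_mem hx hy) (by simpa using sub_mem hx' hy')
  refine Submodule.span_mono ?_ h
  rintro y ⟨u, h1, h2, h3⟩
  exact ⟨u, h1, h2, fun _ => h3 trivial⟩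

/-- Only the length is bounded here, so the leading word of `x` itself is allowed in the reduction.
-/
theorem IsPatternSystem.trivialDeg (hS : IsPatternSystem S) (hI : IsConformalIdeal k 2 I)
    (hSI : S ⊆ I) (hdisj : Disjoint (Submodule.span k (ev '' {w | IsListed w})) I)
    {x : Conf k Unit ![2, 2]} (hx : x ∈ I) (hx' : x ∈ wordSpan k ![2, 2] fun u => u.ind = 0)
    (d : Prop) : TrivialDeg S d x := by
  obtain ⟨c, hc, hc0⟩ := mem_wordSpan_iff.1 hx'
  rcases c.support.eq_empty_or_nonempty with h0 | h0
  · left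
    rw [hc.2, Finsupp.support_eq_empty.1 h0, Finsupp.sum_zero_index]
  obtain ⟨w, hw, hmax⟩ := Word.exists_greatest h0
  refine Or.inr ⟨w, c w, ⟨c, hc, rfl, Finsupp.mem_support_iff.1 hw, hmax⟩, ?_⟩
  have h := hS.mem_span (P := fun u => u = w ∨ u.lt w) (d := True) hI hSI hdisj
    (fun u v _ hv hlt => by
      rcases hv with rfl | hv
      exacts [Or.inr hlt, Or.inr (Word.lt_trans hlt hv)]) hx
    (mem_wordSpan_iff.2 ⟨c, hc, fun u hu => ⟨hmax u hu, fun _ => hc0 u hu⟩⟩)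
  refine Submodule.span_mono ?_ h
  rintro y ⟨u, h1, h2, h3⟩
  refine ⟨u, h1, ?_, fun _ => h3 trivial⟩
  rcases h2 with rfl | h2
  exacts [le_rfl, Word.lt_length_le h2]

theorem IsPatternSystem.exists_of_hasLead [CharZero k] (hS : IsPatternSystem S) (hs : s ∈ S)
    {t : Word 2 Unit} {r : k} (ht : HasLead s t r) :
    ∃ T ∈ patterns, HasPattern s T ∧ t = seqWord T 0 := by
  obtain ⟨T, hT, hsT⟩ := hS.hasPattern s hs
  exact ⟨T, hT, hsT, ht.unique (hsT.hasLead hT)⟩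

theorem HasPattern.sub_mem (h : HasPattern s T) (d : Prop) : s - ev (seqWord T 0) ∈
    wordSpan k ![2, 2] fun u => u.lt (seqWord T 0) ∧ (d → u.ind = 0) :=
  wordSpan_mono (fun _ _ h => ⟨Word.lt_of_length_lt h.1, fun _ => h.2⟩) h

/-- A system with the given leading words is a Gröbner–Shirshov basis if the listed words are
linearly independent modulo an ideal containing it. -/
theorem IsPatternSystem.isGSBasis [CharZero k] (hS : IsPatternSystem S)
    (hI : IsConformalIdeal k 2 I) (hSI : S ⊆ I)
    (hdisj : Disjoint (Submodule.span k (ev '' {w | IsListed w})) I) : IsGSBasis S where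
  monic s hs := by
    obtain ⟨T, hT, hsT⟩ := hS.hasPattern s hs
    exact ⟨_, hsT.hasLead hT⟩
  including f hf g hg tf tg hltf hltg _ L m v heq := by
    obtain ⟨T, hT, hfT, rfl⟩ := hS.exists_of_hasLead hf hltf
    obtain ⟨T', hT', hgT, rfl⟩ := hS.exists_of_hasLead hg hltg
    have hn := isNormal_seqWord (i := 0).2 (below_of_mem_patterns hT)
    have h0 : (seqWord T 0).ind = 0 := rfl
    rw [heq] at hn h0
    obtain ⟨hL, hn⟩ := isNormal_prepend.1 hn
    refine hS.trivialBelow hI hSI hdisj (hSI hf) (lmul_mem hI L (hI.op_right m _ (hSI hg) _))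
      (hfT.sub_mem _) ?_ _
    rw [heq]
    exact lmul_sub_mem (hgT.op_sub_mem hT' True m (isNormal_append.1 hn).2.2 fun _ => h0) hL
  rightIncluding f hf g hg tf tg hltf hltg L i j hij heq := by
    obtain ⟨T, hT, hfT, rfl⟩ := hS.exists_of_hasLead hf hltf
    obtain ⟨T', hT', hgT, rfl⟩ := hS.exists_of_hasLead hg hltg
    -- The leading words have index `0`, so `i = j`; disjoint supports then leave only `i = j = 0`.
    have hind : i = j := by
      have := congrArg Word.ind heq
      simpa [Word.shift, Word.prepend, seqWord] using this
    obtain rfl : i = 0 := by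
      subst hind
      funext l
      simpa using hij l
    subst hind
    have hz : ∀ w : Word 2 Unit, w.shift 0 = w := fun w => by simp [Word.shift]
    rw [hz, hz] at heq
    rw [hz, derPow_zero, derPow_zero]
    have hn := isNormal_seqWord (i := 0).2 (below_of_mem_patterns hT)
    rw [heq] at hn
    refine hS.trivialBelow hI hSI hdisj (hSI hf) (lmul_mem hI L (hSI hg)) (hfT.sub_mem _) ?_ _
    rw [heq]
    exact lmul_sub_mem (hgT.sub_mem _) (isNormal_prepend.1 hn).1
  intersection f hf g hg tf tg hltf hltg _ L m v hL _ hv heq _ := by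
    obtain ⟨T, hT, hfT, rfl⟩ := hS.exists_of_hasLead hf hltf
    obtain ⟨T', hT', hgT, rfl⟩ := hS.exists_of_hasLead hg hltg
    have hv0 : v.ind = 0 := congrArg Word.ind heq
    refine hS.trivialBelow hI hSI hdisj (hI.op_right m _ (hSI hf) _) (lmul_mem hI L (hSI hg))
      (hfT.op_sub_mem hT True m hv fun _ => hv0) ?_ _
    rw [heq]
    exact lmul_sub_mem (hgT.sub_mem _) hL
  leftMul f hf b m _ := by
    obtain ⟨T, hT, hfT⟩ := hS.hasPattern f hf
    refine hS.trivialDeg hI hSI hdisj (hI.op_left m _ _ (hSI hf)) ?_ _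
    refine map_mem_of_wordSpan (op k m (gen _ b)) (fun u hu h => ?_) (hfT.mem_wordSpan hT)
    exact wordSpan_mono (fun _ _ h => h.2 trivial) (op_gen_mem_wordSpan True b m
      (ev_mem_wordSpan (P := fun w => w.length = u.length ∧ (True → w.ind = 0)) hu
        ⟨rfl, fun _ => h⟩))
  -- Vacuous: all elements of `S` are D-free.
  rightMul f hf hnf := by
    obtain ⟨T, hT, hfT⟩ := hS.hasPattern f hf
    exact absurd (isDFree_iff.2 (hfT.mem_wordSpan hT)) hnf

theorem IsPatternSystem.isIrreducible_iff [CharZero k] (hS : IsPatternSystem S) (w : Word 2 Unit) :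
    IsIrreducible S w ↔ IsListed w := by
  constructor
  · rintro ⟨hw, h⟩
    by_contra hl
    obtain ⟨y, ⟨s, hs, t, ht, L, -, ⟨hd, m, b, -, -, -, heq⟩ | ⟨i, -, heq⟩⟩, -⟩ :=
      hS.exists_normalSWord hw hl
    · exact (h s hs t 1 ht L).1 hd m b heq
    · exact (h s hs t 1 ht L).2 i heq
  · intro hl
    refine ⟨hl.isNormal, fun s hs t r ht L => ?_⟩
    obtain ⟨T, hT, -, rfl⟩ := hS.exists_of_hasLead hs ht
    have key : ∀ l₂, w.init.map Prod.snd ≠ L.map Prod.snd ++ T ++ l₂ := by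
      intro l₂ heq
      rw [← seqWord_map w, isListed_seqWord, heq] at hl
      exact not_avoids_of_mem_patterns hT hl.avoids.of_append
    have hTT : (T.map (Prod.mk ())).map Prod.snd = T := by
      rw [List.map_map]
      exact List.map_id' T
    constructor
    · rintro - m b rfl
      refine key (m :: b.init.map Prod.snd) ?_
      simp only [Word.prepend, Word.append, seqWord, List.map_append, List.map_cons, hTT,
        List.append_assoc]
    · rintro i rfl
      refine key [] ?_
      simp only [Word.prepend, Word.shift, seqWord, List.map_append, hTT, List.append_nil]

end GroebnerShirshov

/-! ### Independence of the listed words modulo an ideal. -/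

section Quotient

variable {k : Type*} [Field k]

theorem linearIndependent_clVal :
    LinearIndependent k fun l : {l | IsListedSeq l} => clVal (k := k) l.1 := by
  choose j hj using fun l : {l | IsListedSeq l} => exists_clList l.2
  have hinj : Function.Injective j := fun l l' h => Subtype.ext (by rw [← hj l, ← hj l', h])
  have hval : (fun l : {l | IsListedSeq l} => clVal (k := k) l.1) =
      LinearMap.inr k (Fin 8 → Polynomial k) (Fin 8 → Polynomial k) ∘ (clVec ∘ j) := by
    funext l
    rw [← hj l, clVal_clList]
    simp
  rw [hval]
  exact (linearIndependent_clVec.comp j hinj).map' _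
    (LinearMap.ker_eq_bot.2 LinearMap.inr_injective)

/-- There is an ideal containing `a⟨0,0⟩a - a` modulo which the listed words are linearly
independent. -/
theorem exists_ideal [CharZero k] : ∃ I : Submodule k (Conf k Unit ![2, 2]),
    IsConformalIdeal k 2 I ∧ op k ![0, 0] (gen _ ()) (gen _ ()) - gen _ () ∈ I ∧
      LinearIndependent k fun w : {w : Word 2 Unit // IsListed w} => I.mkQ (ev w.1) := by
  obtain ⟨φ, h1, h2, h3⟩ := exists_representation (clPairDer_commute (k := k)) clPairDer_clIdem
  -- The kernel of the idempotent representation serves as the ideal. It contains `a⟨0,0⟩a - a`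
  -- because `(a⟨0,0⟩a)(n) = a · a dⁿ` and `a² = a`.
  refine ⟨LinearMap.ker φ, ⟨fun i x hx => ?_, fun m x y hy => ?_, fun m x hx y => ?_⟩, ?_, ?_⟩
  · rw [LinearMap.mem_ker] at *
    rw [h2, hx, map_zero]
  · rw [LinearMap.mem_ker] at *
    rw [h3, hy, map_zero]
  · rw [LinearMap.mem_ker] at *
    rw [h3, hx, map_zero, LinearMap.zero_apply]
  · have h0 : (![0, 0] : Idx 2) = 0 := by decide
    rw [LinearMap.mem_ker, map_sub, h3, h1, h0, sub_eq_zero]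
    funext n
    rw [seq_op_zero]
    simp only [seqOf, Pi.zero_apply, pow_zero, mul_one]
    rw [← mul_assoc, clIdem_mul_self]
  · have hv : ∀ i, clPairDer k i (clVec (0, 0), 0) = 0 := by
      intro i
      rw [clPairDer_apply, map_zero, map_zero, add_zero]
      fin_cases i
      · simp only [Fin.zero_eta, clDer_zero_apply, clVec, Prod.mk_eq_zero, and_true]
        ext j : 1; fin_cases j <;> simp
      · simp only [Fin.mk_one, clDer_one_apply, clVec, Prod.mk_eq_zero, and_true]
        ext j : 1; fin_cases j <;> simp
    have h := linearIndependent_of_wordVal clPairDer_commute hv h1 h2 h3 linearIndependent_clVal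
    have h' : LinearIndependent k fun w : {w : Word 2 Unit // w.init.map Prod.snd ∈
        {l | IsListedSeq l}} => (LinearMap.ker φ).mkQ (ev w.1) := by
      refine LinearIndependent.of_comp ((LinearMap.ker φ).liftQ φ le_rfl) ?_
      exact h
    exact h'

theorem disjoint_of_linearIndependent {I : Submodule k (Conf k Unit ![2, 2])}
    (h : LinearIndependent k fun w : {w : Word 2 Unit // IsListed w} => I.mkQ (ev w.1)) :
    Disjoint (Submodule.span k (ev '' {w | IsListed w})) I := by
  have := Submodule.range_ker_disjoint (f := I.mkQ)
    (v := fun w : {w : Word 2 Unit // IsListed w} => ev w.1) h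
  rw [Submodule.ker_mkQ] at this
  have himg : (ev '' {w : Word 2 Unit | IsListed w} : Set (Conf k Unit ![2, 2])) =
      Set.range fun w : {w : Word 2 Unit // IsListed w} => ev w.1 := Set.image_eq_range _ _
  rw [himg]
  exact this

end Quotient

end NConformal

/-! ### Proof of the theorem. -/

open NConformal in
theorem theorem4p2 (k : Type*) [Field k] [CharZero k]
    (a f g h p q s : NConformal.Conf k Unit ![2, 2])
    (ha : a = NConformal.gen _ ())
    (hf : f = NConformal.op k ![0, 0] a a - a)
    (hg : g = NConformal.op k ![1, 0] a (NConformal.op k ![1, 0] a a))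
    (hh : h = NConformal.op k ![0, 1] a (NConformal.op k ![0, 1] a a))
    (hp : p = NConformal.op k ![1, 1] a (NConformal.op k ![1, 0] a a))
    (hq : q = NConformal.op k ![1, 1] a (NConformal.op k ![0, 1] a a))
    (hs : s = NConformal.op k ![1, 1] a (NConformal.op k ![1, 1] a a)) :
    NConformal.IsGSBasis ({f, g, h, p, q, s} : Set (NConformal.Conf k Unit ![2, 2])) ∧
    NConformal.idealSpan k 2 ({f, g, h, p, q, s} : Set (NConformal.Conf k Unit ![2, 2])) =
      NConformal.idealSpan k 2 {f} ∧
    (∀ w : NConformal.Word 2 Unit,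
      NConformal.IsIrreducible ({f, g, h, p, q, s} : Set (NConformal.Conf k Unit ![2, 2])) w ↔
        NConformal.IsListed w) ∧
    ∃ b : Module.Basis {w : NConformal.Word 2 Unit // NConformal.IsListed w} k
        (NConformal.Conf k Unit ![2, 2] ⧸ NConformal.idealSpan k 2 {f}),
      ∀ w, b w = (NConformal.idealSpan k 2 {f}).mkQ (NConformal.ev w.1) := by
  have hlead1 : ∀ m : Idx 2, (ev (seqWord [m] 0) : Conf k Unit ![2, 2]) = op k m a a := by
    intro m
    simp [seqWord, ev, lmul, derPow_zero, ha]
  have hlead2 : ∀ m n : Idx 2, (ev (seqWord [m, n] 0) : Conf k Unit ![2, 2]) =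
      op k m a (op k n a a) := by
    intro m n
    simp [seqWord, ev, lmul, derPow_zero, ha]
  have hf' : HasPattern f [![0, 0]] := by
    have h0 : (ev (seqWord [] 0) : Conf k Unit ![2, 2]) = a := by
      simp [seqWord, ev, lmul, derPow_zero, ha]
    have h1 : f - ev (seqWord [![0, 0]] 0) = -ev (seqWord [] 0) := by
      rw [hlead1, h0, hf]
      abel
    rw [HasPattern, h1]
    exact neg_mem (ev_mem_wordSpan (isNormal_seqWord.2 (by simp)) ⟨by simp [Word.length, seqWord], rfl⟩)
  have htriple : ∀ m n : Idx 2, HasPattern (op k m a (op k n a a)) [m, n] := by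
    intro m n
    rw [HasPattern, hlead2, sub_self]
    exact zero_mem _
  have hS : IsPatternSystem ({f, g, h, p, q, s} : Set (Conf k Unit ![2, 2])) := by
    constructor
    · intro x hx
      simp only [Set.mem_insert_iff, Set.mem_singleton_iff] at hx
      rcases hx with rfl | rfl | rfl | rfl | rfl | rfl
      · exact ⟨_, by simp [patterns], hf'⟩
      · exact ⟨[![1, 0], ![1, 0]], by simp [patterns], hg ▸ htriple _ _⟩
      · exact ⟨[![0, 1], ![0, 1]], by simp [patterns], hh ▸ htriple _ _⟩
      · exact ⟨[![1, 1], ![1, 0]], by simp [patterns], hp ▸ htriple _ _⟩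
      · exact ⟨[![1, 1], ![0, 1]], by simp [patterns], hq ▸ htriple _ _⟩
      · exact ⟨[![1, 1], ![1, 1]], by simp [patterns], hs ▸ htriple _ _⟩
    · intro T hT
      simp only [patterns, List.mem_cons, List.not_mem_nil, or_false] at hT
      rcases hT with rfl | rfl | rfl | rfl | rfl | rfl
      · exact ⟨f, by simp, hf'⟩
      · exact ⟨g, by simp, hg ▸ htriple _ _⟩
      · exact ⟨h, by simp, hh ▸ htriple _ _⟩
      · exact ⟨p, by simp, hp ▸ htriple _ _⟩
      · exact ⟨q, by simp, hq ▸ htriple _ _⟩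
      · exact ⟨s, by simp, hs ▸ htriple _ _⟩
  have hI := idealSpan_isIdeal (k := k) (n := 2) ({f} : Set (Conf k Unit ![2, 2]))
  have hfI : f ∈ idealSpan k 2 {f} := subset_idealSpan _ rfl
  have hSI : ({f, g, h, p, q, s} : Set (Conf k Unit ![2, 2])) ⊆ idealSpan k 2 {f} := by
    obtain ⟨h1, h2, h3, h4, h5⟩ := consequences_mem hI (by rw [← ha, ← hf]; exact hfI)
    rw [← ha] at h1 h2 h3 h4 h5
    intro x hx
    simp only [Set.mem_insert_iff, Set.mem_singleton_iff] at hx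
    rcases hx with rfl | rfl | rfl | rfl | rfl | rfl
    exacts [hfI, hg ▸ h1, hh ▸ h2, hp ▸ h3, hq ▸ h4, hs ▸ h5]
  have hli : LinearIndependent k fun w : {w : Word 2 Unit // IsListed w} =>
      (idealSpan k 2 {f}).mkQ (ev w.1) := by
    -- The ideal generated by `f` is contained in `J`, and independence modulo `J` passes to the
    -- smaller ideal.
    obtain ⟨J, hJ, hfJ, hli⟩ := exists_ideal (k := k)
    have hle : idealSpan k 2 {f} ≤ J := idealSpan_le hJ (by
      rw [Set.singleton_subset_iff, hf, ha]
      exact hfJ)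
    exact LinearIndependent.of_comp ((idealSpan k 2 {f}).mapQ J LinearMap.id hle) hli
  have hdisj := disjoint_of_linearIndependent hli
  refine ⟨hS.isGSBasis hI hSI hdisj, le_antisymm (idealSpan_le hI hSI)
    (idealSpan_le (idealSpan_isIdeal _) ?_), hS.isIrreducible_iff, ?_⟩
  · rw [Set.singleton_subset_iff]
    exact subset_idealSpan _ (Set.mem_insert _ _)
  · refine ⟨Module.Basis.mk hli ?_, fun w => Module.Basis.mk_apply hli _ w⟩
    rintro x -
    obtain ⟨x, rfl⟩ := Submodule.mkQ_surjective _ x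
    have hx : x ∈ wordSpan k ![2, 2] fun w : Word 2 Unit => True ∧ (False → w.ind = 0) := by
      simp [wordSpan_true]
    -- Reduction without any bound on the words: the normal `S`-words die in the quotient and the
    -- listed words remain.
    obtain ⟨y, hy, z, hz, rfl⟩ := Submodule.mem_sup.1 (hS.mem_sup (fun _ _ _ _ _ => trivial) hx)
    have hyI : y ∈ idealSpan k 2 {f} := by
      refine Submodule.span_le.2 ?_ hy
      rintro y ⟨u, hu, -⟩
      exact hu.mem hI hSI
    rw [map_add, Submodule.mkQ_apply, (Submodule.Quotient.mk_eq_zero _).2 hyI, zero_add]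
    refine Submodule.span_induction ?_ (by simp) (fun x y _ _ hx hy => by
      rw [map_add]; exact add_mem hx hy) (fun c x _ hx => by
      rw [map_smul]; exact Submodule.smul_mem _ _ hx) hz
    rintro _ ⟨w, hw, rfl⟩
    exact Submodule.subset_span ⟨⟨w, hw⟩, rfl⟩
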